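/- Let $\mathbb L^4$ be $\mathbb R^4$ with $\langle x,y\rangle=-x_0y_0+x_1y_1+x_2y_2+x_3y_3$, also extended complex-bilinearly to $\mathbb C^4$, and let $\mathcal C=\{x:\langle x,x\rangle=0,\ x_0>0\}$ be the future light cone. Let $M\subset\mathbb C$ be open, connected and simply connected. For a smooth $f:M\to\mathbb L^4$ write $f_w=\tfrac12(f_u-if_v)$ and $f_{\overline w}=\tfrac12(f_u+if_v)$, where $w=u+iv$. Call $f$ a conformal immersion if it is a smooth immersion with $\langle f_w,f_w\rangle=0$ and $\langle f_w,\overline{f_w}\rangle>0$ on $M$. It is totally umbilical if the component $[f_{ww}]^\perp$ of $f_{ww}$ orthogonal to $f_w$ and $\overline{f_w}$ vanishes on $M$. Its mean curvature vector is $H(f)=f_{w\overline w}/\langle f_w,\overline{f_w}\rangle$. Where $f_{1,w}-if_{2,w}\neq0$, put $$a(f)=\frac{f_{0,w}+f_{3,w}}{f_{1,w}-if_{2,w}},\qquad b(f)=\frac{f_{0,w}-f_{3,w}}{f_{1,w}-if_{2,w}},\qquad \mu(f)=\frac{f_{1,w}-if_{2,w}}{2}.$$ Let $F:M\to\mathbb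 L^4$ be a totally umbilical conformal immersion with $F_{1,w}-iF_{2,w}\ne0$ everywhere on $M$, such that $a(F)$ and $b(F)$ are non-constant anti-holomorphic functions on $M$. Then: 1. There is a conformal immersion $f:M\to\mathbb L^4$ with values in the light cone such that $a(f)=a(F)$, $b(f)=b(F)$ and $\mu(f)=\mu(F)$ on $M$. It can be taken with values in the future light cone $\mathcal C$ unless $H(F)$ is timelike and past directed at every point of $M$; in that case it can be taken with values in the past light cone $-\mathcal C$. 2. There is a vector $v$ with $\langle v,v\rangle=1$ or $\langle v,v\rangle=-1$ such that $F(M)\subset F(w_0)+v^\perp$ for every $w_0\in M$. Moreover, whenever $w_0\in M$ and $v\in\mathbb L^4$ are such that $F(M)\subset F(w_0)+v^\perp$: (2.1) if $\langle v,v\rangle=-1$, then for some $r>0$ an affine isometry of $\mathbb L^4$ maps $F(M)$ onto a relatively open subset of the round sphere $\{x_0=0,\ x_1^2+x_2^2+x_3^2=r^2\}$ of $\mathbb R^3=\{x_0=0\}$; (2.2) if $\langle v,v\rangle=1$, then for some $r>0$ an affine isometry of $\mathbb L^4$ maps $F(M)$ onto a relatively open subset of the hyperbolic surface $\{x_3=0,\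 -x_0^2+x_1^2+x_2^2=-r^2,\ x_0>0\}$ of $\mathbb R^3_1=\{x_3=0\}$. -/

import Mathlib

open scoped ContDiff

noncomputable section

/-- The underlying vector space of Minkowski space, coordinates `x 0, x 1, x 2, x 3`. -/
abbrev L4 : Type := Fin 4 → ℝ

/-- The Lorentz product `-x₀y₀ + x₁y₁ + x₂y₂ + x₃y₃`. -/
def lor (x y : L4) : ℝ := -(x 0 * y 0) + x 1 * y 1 + x 2 * y 2 + x 3 * y 3

/-- The complex bilinear extension of the Lorentz product to `ℂ⁴`. -/
def lorC (x y : Fin 4 → ℂ) : ℂ := -(x 0 * y 0) + x 1 * y 1 + x 2 * y 2 + x 3 * y 3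

/-- Componentwise complex conjugation on `ℂ⁴`. -/
def conjVec (z : Fin 4 → ℂ) : Fin 4 → ℂ := fun j => (starRingEnd ℂ) (z j)

/-- `∂g/∂w = (∂g/∂u - i ∂g/∂v) / 2` for `w = u + i v`. -/
def dw (g : ℂ → ℂ) (w : ℂ) : ℂ :=
  (fderiv ℝ g w 1 - Complex.I * fderiv ℝ g w Complex.I) / 2

/-- `∂g/∂w̄ = (∂g/∂u + i ∂g/∂v) / 2` for `w = u + i v`. -/
def dwbar (g : ℂ → ℂ) (w : ℂ) : ℂ :=
  (fderiv ℝ g w 1 + Complex.I * fderiv ℝ g w Complex.I) / 2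

/-- The vector `f_w ∈ ℂ⁴`. -/
def fw (f : ℂ → L4) (w : ℂ) : Fin 4 → ℂ := fun j => dw (fun z => (f z j : ℂ)) w

/-- The vector `f_{ww} ∈ ℂ⁴`. -/
def fww (f : ℂ → L4) (w : ℂ) : Fin 4 → ℂ := fun j => dw (fun z => fw f z j) w

/-- The vector `f_{w w̄} ∈ ℂ⁴`. -/
def fwwbar (f : ℂ → L4) (w : ℂ) : Fin 4 → ℂ := fun j => dwbar (fun z => fw f z j) w

/-- `f` is a smooth conformal spacelike immersion of the open set `M` into Minkowski space. -/
structure IsConformalImmersion (f : ℂ → L4) (M : Set ℂ) : Prop where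
  smooth : ContDiffOn ℝ ∞ f M
  immersion : ∀ w ∈ M, Function.Injective (fderiv ℝ f w)
  isotropic : ∀ w ∈ M, lorC (fw f w) (fw f w) = 0
  spacelike : ∀ w ∈ M, ∃ r : ℝ, 0 < r ∧
    lorC (fw f w) (conjVec (fw f w)) = ((r ^ 2 / 2 : ℝ) : ℂ)

/-- The function `f_{1,w} - i f_{2,w}`, the denominator in `a(f)` and `b(f)`. -/
def den (f : ℂ → L4) (w : ℂ) : ℂ := fw f w 1 - Complex.I * fw f w 2

/-- `a(f)`. -/
def aMap (f : ℂ → L4) (w : ℂ) : ℂ := (fw f w 0 + fw f w 3) / den f w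

/-- `b(f)`. -/
def bMap (f : ℂ → L4) (w : ℂ) : ℂ := (fw f w 0 - fw f w 3) / den f w

/-- `μ(f)`. -/
def muMap (f : ℂ → L4) (w : ℂ) : ℂ := den f w / 2

/-- The component of `z ∈ ℂ⁴` orthogonal to the complexified tangent plane of a conformal
immersion `f` at `w`. That plane is spanned by the isotropic vectors `f_w` and `conj f_w`. -/
def normalPart (f : ℂ → L4) (w : ℂ) (z : Fin 4 → ℂ) : Fin 4 → ℂ :=
  z - (lorC z (conjVec (fw f w)) / lorC (fw f w) (conjVec (fw f w))) • fw f w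
    - (lorC z (fw f w) / lorC (fw f w) (conjVec (fw f w))) • conjVec (fw f w)

/-- A conformal immersion is totally umbilical if the normal part of `f_{ww}` vanishes. -/
def IsTotallyUmbilical (f : ℂ → L4) (M : Set ℂ) : Prop :=
  ∀ w ∈ M, normalPart f w (fww f w) = 0

/-- `a` is anti-holomorphic on `M`: its conjugate is holomorphic. -/
def IsAntiHolomorphicOn (a : ℂ → ℂ) (M : Set ℂ) : Prop :=
  DifferentiableOn ℂ (fun w => (starRingEnd ℂ) (a w)) M

/-- `a` is constant on `M`. -/
def IsConstantOn (a : ℂ → ℂ) (M : Set ℂ) : Prop := ∃ c : ℂ, ∀ w ∈ M, a w = c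

/-- The mean curvature vector `H(f) = (2 / g₁₁) f_{w w̄}` with `g₁₁ = 2 ⟨f_w, conj f_w⟩`. For a
smooth `f` the vector `f_{w w̄}` is real, so the real parts are all of it. -/
def meanCurvature (f : ℂ → L4) (w : ℂ) : L4 := fun j =>
  2 / (2 * (lorC (fw f w) (conjVec (fw f w))).re) * (fwwbar f w j).re

/-- Past directed timelike vectors. -/
def IsPastTimelike (x : L4) : Prop := lor x x < 0 ∧ x 0 < 0

/-- The future directed light cone. -/
def futureCone : Set L4 := {x | lor x x = 0 ∧ 0 < x 0}

/-- The past directed light cone. -/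
def pastCone : Set L4 := {x | lor x x = 0 ∧ x 0 < 0}

/-- The affine hyperplane `p + v^⊥`. -/
def affHyperplane (p v : L4) : Set L4 := {x | lor (x - p) v = 0}

/-- `f` and `F` have the same `a`, `b` and `μ` on `M`. -/
def SameData (f F : ℂ → L4) (M : Set ℂ) : Prop :=
  ∀ w ∈ M, aMap f w = aMap F w ∧ bMap f w = bMap F w ∧ muMap f w = muMap F w

/-- Two subsets are congruent if an affine isometry of Minkowski space maps one onto the other. -/
def LorentzCongruent (S S' : Set L4) : Prop :=
  ∃ T : L4 ≃ᵃ[ℝ] L4,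
    (∀ x y : L4, lor (T x - T y) (T x - T y) = lor (x - y) (x - y)) ∧ T '' S = S'

/-- The round sphere of radius `r` in the Euclidean space `ℝ³ = {x₀ = 0}`. -/
def roundSphere (r : ℝ) : Set L4 := {x | x 0 = 0 ∧ lor x x = r ^ 2}

/-- The hyperbolic surface of radius `r` (one sheet of the hyperboloid `⟨x, x⟩ = -r²`) in the
Lorentzian space `ℝ³₁ = {x₃ = 0}`. -/
def hyperbolicSurface (r : ℝ) : Set L4 := {x | x 3 = 0 ∧ lor x x = -r ^ 2 ∧ 0 < x 0}

/-- `S` is congruent to a relatively open piece of `Q`. -/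
def CongruentToOpenPiece (S Q : Set L4) : Prop :=
  ∃ U : Set L4, IsOpen U ∧ LorentzCongruent S (U ∩ Q)

end

/-! Write `φ = f_w`, `ρ = ⟨φ, φ̄⟩` and `H` for the mean curvature vector, so that `φ_w̄ = ρH`.
Umbilicity says `φ_w = κφ`. Comparing the mixed derivatives of `φ` gives `H_w = (κ_w̄ / ρ) φ`, and
differentiating `⟨H, φ⟩ = 0` identifies the factor as `-⟨H, H⟩` (`hasWirtingerVec_meanCurvature`).
Everything else comes from three conserved quantities: the number `s = ⟨H, H⟩`, the normal vector `i
ρ⁻¹ φ × φ̄ × H` of norm `-s` (`hasWirtingerVec_crossNormal`), and, for `s ≠ 0`, the center `p = F +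
H/s` (`exists_center`).

If `s = 0` then `H` is constant. For `H = 0` the function `a` is both holomorphic and
anti-holomorphic. For `H ≠ 0` null, orthogonality to `φ` is a relation in `a` and `b` that forces
one of them to be constant. Hence `s ≠ 0` (`lor_meanCurvature_ne_zero`).

Part 1: with `v` the constant normal, the translate `F + v/s - p = (v - H)/s` is null because `⟨v,
v⟩ = -s` and `⟨v, H⟩ = 0`, and a translation keeps `a`, `b`, `μ`. Its product with `v` and with `H`
is `-1`, so whichever of these is timelike decides the time orientation.

Part 2: `F - p` lies in `v^⊥` and in the quadric `⟨x, x⟩ = 1/s`; the sign of `⟨v, v⟩` is opposite to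
that of `s`, which selects sphere or hyperbolic surface. Relative openness follows by projecting to
a tangent plane (`exists_isOpen_inter_subset_image`). -/

/-! ### Wirtinger calculus. -/

/-- `g` is real differentiable at `w` with Wirtinger derivatives `g_w = p` and `g_w̄ = q`. -/
def HasWirtinger (g : ℂ → ℂ) (p q w : ℂ) : Prop :=
  HasFDerivAt g (p • (ContinuousLinearMap.id ℝ ℂ) + q • (Complex.conjCLE : ℂ →L[ℝ] ℂ)) w

namespace HasWirtinger

variable {g k : ℂ → ℂ} {p q p' q' w : ℂ}

lemma dw_eq (h : HasWirtinger g p q w) : dw g w = p := by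
  have := HasFDerivAt.fderiv h
  simp only [dw, this]
  simp
  linear_combination (-1/2 * p + 1/2 * q) * Complex.I_sq

lemma dwbar_eq (h : HasWirtinger g p q w) : dwbar g w = q := by
  have := HasFDerivAt.fderiv h
  simp only [dwbar, this]
  simp
  linear_combination (1/2 * p - 1/2 * q) * Complex.I_sq

lemma of_differentiableAt (h : DifferentiableAt ℝ g w) :
    HasWirtinger g (dw g w) (dwbar g w) w := by
  refine HasFDerivAt.congr_fderiv (h.hasFDerivAt) ?_
  ext z
  have hz : z = z.re • (1 : ℂ) + z.im • Complex.I := by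
    simp
  have h2 : fderiv ℝ g w z = z.re * fderiv ℝ g w 1 + z.im * fderiv ℝ g w Complex.I := by
    conv_lhs => rw [hz]
    rw [map_add, map_smul, map_smul, Complex.real_smul, Complex.real_smul]
  rw [h2]
  have hz1 : z = z.re + z.im * Complex.I := (Complex.re_add_im z).symm
  have hz2 : (starRingEnd ℂ) z = z.re - z.im * Complex.I := by
    apply Complex.ext <;> simp
  simp only [dw, dwbar, add_apply, smul_apply,
    ContinuousLinearMap.id_apply, smul_eq_mul, ContinuousLinearEquiv.coe_coe,
    Complex.conjCLE_apply, hz2]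
  linear_combination (-(fderiv ℝ g w 1 - Complex.I * fderiv ℝ g w Complex.I) / 2) * hz1
    + (z.im : ℂ) * fderiv ℝ g w Complex.I * Complex.I_sq

lemma congr_deriv (h : HasWirtinger g p q w) (hp : p = p') (hq : q = q') :
    HasWirtinger g p' q' w := by
  subst hp hq; exact h

lemma congr_of_eventuallyEq (h : HasWirtinger g p q w) (hk : k =ᶠ[nhds w] g) :
    HasWirtinger k p q w :=
  HasFDerivAt.congr_of_eventuallyEq h hk

lemma congr_on {M : Set ℂ} (h : HasWirtinger g p q w) (hM : IsOpen M) (hw : w ∈ M)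
    (hk : ∀ z ∈ M, k z = g z) : HasWirtinger k p q w :=
  h.congr_of_eventuallyEq (Filter.eventuallyEq_of_mem (hM.mem_nhds hw) hk)

lemma const (c : ℂ) : HasWirtinger (fun _ => c) 0 0 w := by
  refine HasFDerivAt.congr_fderiv (hasFDerivAt_const c w) ?_
  ext z
  simp

lemma add (h : HasWirtinger g p q w) (h' : HasWirtinger k p' q' w) :
    HasWirtinger (fun z => g z + k z) (p + p') (q + q') w := by
  refine HasFDerivAt.congr_fderiv (HasFDerivAt.add h h') ?_
  ext z
  simp
  ring

lemma sub (h : HasWirtinger g p q w) (h' : HasWirtinger k p' q' w) :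
    HasWirtinger (fun z => g z - k z) (p - p') (q - q') w := by
  refine HasFDerivAt.congr_fderiv (HasFDerivAt.sub h h') ?_
  ext z
  simp
  ring

lemma mul (h : HasWirtinger g p q w) (h' : HasWirtinger k p' q' w) :
    HasWirtinger (fun z => g z * k z) (p * k w + g w * p') (q * k w + g w * q') w := by
  refine HasFDerivAt.congr_fderiv (HasFDerivAt.mul h h') ?_
  ext z
  simp
  ring

lemma conj (h : HasWirtinger g p q w) :
    HasWirtinger (fun z => (starRingEnd ℂ) (g z)) ((starRingEnd ℂ) q) ((starRingEnd ℂ) p) w := by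
  have := (Complex.conjCLE : ℂ →L[ℝ] ℂ).hasFDerivAt.comp w h
  refine this.congr_fderiv ?_
  ext z
  simp
  ring

end HasWirtinger

lemma hasWirtinger_of_hasDerivAt {g : ℂ → ℂ} {p w : ℂ} (h : HasDerivAt g p w) :
    HasWirtinger g p 0 w := by
  refine HasFDerivAt.congr_fderiv (h.hasFDerivAt.restrictScalars ℝ) ?_
  ext z
  simp
  ring

/-- The source of every conserved quantity below. -/
lemma constant_of_hasWirtinger_zero {g : ℂ → ℂ} {M : Set ℂ} (hMo : IsOpen M)
    (hMc : IsPreconnected M) (h : ∀ w ∈ M, HasWirtinger g 0 0 w) {x y : ℂ} (hx : x ∈ M)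
    (hy : y ∈ M) : g x = g y := by
  have h' : ∀ w ∈ M, HasFDerivAt g (0 : ℂ →L[ℝ] ℂ) w := fun w hw =>
    HasFDerivAt.congr_fderiv (h w hw) (by ext z; simp)
  exact hMo.is_const_of_fderiv_eq_zero hMc
    (fun w hw => (h' w hw).differentiableAt.differentiableWithinAt)
    (fun w hw => (h' w hw).fderiv) hx hy

section smooth

variable {g : ℂ → ℂ} {M : Set ℂ}

lemma hasWirtinger_of_contDiffOn (hg : ContDiffOn ℝ ∞ g M) (hMo : IsOpen M) {w : ℂ} (hw : w ∈ M) :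
    HasWirtinger g (dw g w) (dwbar g w) w :=
  .of_differentiableAt ((hg.contDiffAt (hMo.mem_nhds hw)).differentiableAt (by simp))

lemma contDiffOn_fderiv_apply (hg : ContDiffOn ℝ ∞ g M) (hMo : IsOpen M) (e : ℂ) :
    ContDiffOn ℝ ∞ (fun z => fderiv ℝ g z e) M :=
  (hg.fderiv_of_isOpen hMo (by simp)).clm_apply contDiffOn_const

lemma contDiffOn_dw (hg : ContDiffOn ℝ ∞ g M) (hMo : IsOpen M) : ContDiffOn ℝ ∞ (dw g) M := by
  unfold dw
  exact ((contDiffOn_fderiv_apply hg hMo 1).sub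
    (contDiffOn_const.mul (contDiffOn_fderiv_apply hg hMo _))).div_const 2

lemma contDiffOn_dwbar (hg : ContDiffOn ℝ ∞ g M) (hMo : IsOpen M) :
    ContDiffOn ℝ ∞ (dwbar g) M := by
  unfold dwbar
  exact ((contDiffOn_fderiv_apply hg hMo 1).add
    (contDiffOn_const.mul (contDiffOn_fderiv_apply hg hMo _))).div_const 2

/-- Symmetry of the second real derivative. Applied to `f` it makes `f_{w w̄}` real; applied to
`f_w` it gives the compatibility equation for `H`. -/
lemma dwbar_dw_comm (hg : ContDiffOn ℝ ∞ g M) (hMo : IsOpen M) {w : ℂ} (hw : w ∈ M) :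
    dwbar (dw g) w = dw (dwbar g) w := by
  have hs : IsSymmSndFDerivAt ℝ g w :=
    (hg.contDiffAt (hMo.mem_nhds hw)).isSymmSndFDerivAt
      (by simpa using WithTop.coe_le_coe.2 (le_top (a := (2 : ℕ∞))))
  have hd : DifferentiableAt ℝ (fderiv ℝ g) w :=
    ((hg.fderiv_of_isOpen hMo (m := ∞) (by simp)).contDiffAt (hMo.mem_nhds hw)).differentiableAt
      (by simp)
  have key : ∀ e : ℂ, HasFDerivAt (fun z => fderiv ℝ g z e)
      ((fderiv ℝ (fderiv ℝ g) w).flip e) w := fun e => by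
    simpa using hd.hasFDerivAt.clm_apply (hasFDerivAt_const e w)
  have h1 : HasFDerivAt (dw g) ((2⁻¹ : ℂ) • ((fderiv ℝ (fderiv ℝ g) w).flip 1
      - Complex.I • (fderiv ℝ (fderiv ℝ g) w).flip Complex.I)) w := by
    have := ((key 1).sub ((key Complex.I).const_mul Complex.I)).const_mul (2⁻¹ : ℂ)
    refine this.congr_of_eventuallyEq (.of_forall fun z => ?_)
    simp [dw]; ring
  have h2 : HasFDerivAt (dwbar g) ((2⁻¹ : ℂ) • ((fderiv ℝ (fderiv ℝ g) w).flip 1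
      + Complex.I • (fderiv ℝ (fderiv ℝ g) w).flip Complex.I)) w := by
    have := ((key 1).add ((key Complex.I).const_mul Complex.I)).const_mul (2⁻¹ : ℂ)
    refine this.congr_of_eventuallyEq (.of_forall fun z => ?_)
    simp [dwbar]; ring
  have hs' := hs.eq 1 Complex.I
  rw [dw, dwbar, h1.fderiv, h2.fderiv]
  simp only [smul_apply, sub_apply,
    add_apply, ContinuousLinearMap.flip_apply, smul_eq_mul]
  rw [hs']
  ring

end smooth

/-! ### Vector-valued derivatives and the complex bilinear product. -/

/-- The vector-valued version of `HasWirtinger`, componentwise. -/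
def HasWirtingerVec (x : ℂ → Fin 4 → ℂ) (p q : Fin 4 → ℂ) (w : ℂ) : Prop :=
  ∀ j, HasWirtinger (fun z => x z j) (p j) (q j) w

lemma HasWirtingerVec.lorC {x y : ℂ → Fin 4 → ℂ} {p q p' q' : Fin 4 → ℂ} {w : ℂ}
    (hx : HasWirtingerVec x p q w) (hy : HasWirtingerVec y p' q' w) :
    HasWirtinger (fun z => lorC (x z) (y z)) (lorC p (y w) + lorC (x w) p')
      (lorC q (y w) + lorC (x w) q') w := by
  have := (((((HasWirtinger.const 0).sub ((hx 0).mul (hy 0)))).add ((hx 1).mul (hy 1))).add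
    ((hx 2).mul (hy 2))).add ((hx 3).mul (hy 3))
  simp only [zero_sub] at this
  exact this.congr_deriv (by simp only [_root_.lorC]; ring) (by simp only [_root_.lorC]; ring)

lemma HasWirtingerVec.conj {x : ℂ → Fin 4 → ℂ} {p q : Fin 4 → ℂ} {w : ℂ}
    (hx : HasWirtingerVec x p q w) :
    HasWirtingerVec (fun z => conjVec (x z)) (conjVec q) (conjVec p) w :=
  fun j => (hx j).conj

lemma HasWirtingerVec.const (c : Fin 4 → ℂ) (w : ℂ) :
    HasWirtingerVec (fun _ => c) 0 0 w := fun j => HasWirtinger.const (c j)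

/-- A real vector regarded as an element of `ℂ⁴`. -/
def toC (x : L4) : Fin 4 → ℂ := fun j => (x j : ℂ)

lemma lorC_toC (x y : L4) : lorC (toC x) (toC y) = (lor x y : ℂ) := by
  simp [lorC, lor, toC]

lemma conjVec_toC (x : L4) : conjVec (toC x) = toC x := by
  funext j; simp [conjVec, toC]

lemma lorC_comm (x y : Fin 4 → ℂ) : lorC x y = lorC y x := by
  simp only [lorC]; ring

lemma lorC_smul_left (c : ℂ) (x y : Fin 4 → ℂ) : lorC (c • x) y = c * lorC x y := by
  simp only [lorC, Pi.smul_apply, smul_eq_mul]; ring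

lemma lorC_smul_right (c : ℂ) (x y : Fin 4 → ℂ) : lorC x (c • y) = c * lorC x y := by
  simp only [lorC, Pi.smul_apply, smul_eq_mul]; ring

lemma lorC_zero_left (x : Fin 4 → ℂ) : lorC 0 x = 0 := by simp [lorC]

lemma lorC_zero_right (x : Fin 4 → ℂ) : lorC x 0 = 0 := by simp [lorC]

lemma lorC_conjVec (x y : Fin 4 → ℂ) :
    lorC (conjVec x) (conjVec y) = (starRingEnd ℂ) (lorC x y) := by
  simp [lorC, conjVec]

lemma conjVec_conjVec (x : Fin 4 → ℂ) : conjVec (conjVec x) = x := by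
  funext j; simp [conjVec]

lemma conjVec_smul (c : ℂ) (x : Fin 4 → ℂ) :
    conjVec (c • x) = (starRingEnd ℂ) c • conjVec x := by
  funext j; simp [conjVec]

/-! ### Structure equations of a totally umbilical surface. -/

section immersion

variable {F : ℂ → L4} {M : Set ℂ} {w : ℂ}

lemma contDiffOn_toC (hF : IsConformalImmersion F M) (j : Fin 4) :
    ContDiffOn ℝ ∞ (fun z => (F z j : ℂ)) M :=
  Complex.ofRealCLM.contDiff.comp_contDiffOn (contDiffOn_pi.1 hF.smooth j)

lemma contDiffOn_fw (hF : IsConformalImmersion F M) (hMo : IsOpen M) (j : Fin 4) :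
    ContDiffOn ℝ ∞ (fun z => fw F z j) M :=
  contDiffOn_dw (contDiffOn_toC hF j) hMo

lemma hasWirtingerVec_toC (hF : IsConformalImmersion F M) (hMo : IsOpen M) (hw : w ∈ M) :
    HasWirtingerVec (fun z => toC (F z)) (fw F w) (conjVec (fw F w)) w := by
  intro j
  have h := hasWirtinger_of_contDiffOn (contDiffOn_toC hF j) hMo hw
  refine h.congr_deriv rfl ?_
  have h' := h.conj
  simp only [Complex.conj_ofReal] at h'
  exact h'.dwbar_eq

lemma hasWirtingerVec_fw (hF : IsConformalImmersion F M) (hMo : IsOpen M) (hw : w ∈ M) :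
    HasWirtingerVec (fw F) (fww F w) (fwwbar F w) w := fun j =>
  hasWirtinger_of_contDiffOn (contDiffOn_fw hF hMo j) hMo hw

lemma conjVec_fwwbar (hF : IsConformalImmersion F M) (hMo : IsOpen M) (hw : w ∈ M) :
    conjVec (fwwbar F w) = fwwbar F w := by
  funext j
  have h1 := (hasWirtingerVec_fw hF hMo hw j).conj
  have h2 : HasWirtinger (dwbar (fun z => (F z j : ℂ)))
      ((starRingEnd ℂ) (fwwbar F w j)) ((starRingEnd ℂ) (fww F w j)) w :=
    h1.congr_on hMo hw fun z hz => (hasWirtingerVec_toC hF hMo hz j).dwbar_eq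
  exact h2.dw_eq.symm.trans (dwbar_dw_comm (contDiffOn_toC hF j) hMo hw).symm

/-- Both come from differentiating `⟨f_w, f_w⟩ = 0`. The first removes the `conj f_w` component of
`f_ww`, the second makes `f_{w w̄}` normal. -/
lemma lorC_fw_deriv (hF : IsConformalImmersion F M) (hMo : IsOpen M) (hw : w ∈ M) :
    lorC (fww F w) (fw F w) = 0 ∧ lorC (fwwbar F w) (fw F w) = 0 := by
  have h := (hasWirtingerVec_fw hF hMo hw).lorC (hasWirtingerVec_fw hF hMo hw)
  have h0 : HasWirtinger (fun z => lorC (fw F z) (fw F z)) 0 0 w :=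
    (HasWirtinger.const 0).congr_on hMo hw hF.isotropic
  have h1 := h.dw_eq.symm.trans h0.dw_eq
  have h2 := h.dwbar_eq.symm.trans h0.dwbar_eq
  rw [lorC_comm (fw F w)] at h1 h2
  exact ⟨by linear_combination h1 / 2, by linear_combination h2 / 2⟩

/-- The conformal factor `⟨f_w, conj f_w⟩`. -/
noncomputable def conformalFactor (f : ℂ → L4) (w : ℂ) : ℂ := lorC (fw f w) (conjVec (fw f w))

/-- The factor `κ` for which `f_ww = κ f_w` on a totally umbilical surface. -/
noncomputable def umbilicFactor (f : ℂ → L4) (w : ℂ) : ℂ :=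
  lorC (fww f w) (conjVec (fw f w)) / conformalFactor f w

lemma conformalFactor_ne_zero (hF : IsConformalImmersion F M) (hw : w ∈ M) :
    conformalFactor F w ≠ 0 := by
  obtain ⟨r, hr, h⟩ := hF.spacelike w hw
  rw [conformalFactor, h]
  have : 0 < r ^ 2 / 2 := by positivity
  exact_mod_cast this.ne'

lemma conformalFactor_eq_ofReal (hF : IsConformalImmersion F M) (hw : w ∈ M) :
    ∃ s : ℝ, 0 < s ∧ conformalFactor F w = s := by
  obtain ⟨r, hr, h⟩ := hF.spacelike w hw
  exact ⟨r ^ 2 / 2, by positivity, h⟩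

lemma fww_eq (hF : IsConformalImmersion F M) (hMo : IsOpen M) (humb : IsTotallyUmbilical F M)
    (hw : w ∈ M) : fww F w = umbilicFactor F w • fw F w := by
  have h := humb w hw
  rw [normalPart, (lorC_fw_deriv hF hMo hw).1, zero_div, zero_smul, sub_zero, sub_eq_zero] at h
  exact h

lemma lorC_fw_fwwbar (hF : IsConformalImmersion F M) (hMo : IsOpen M) (hw : w ∈ M) :
    lorC (fw F w) (fwwbar F w) = 0 := by
  rw [lorC_comm]; exact (lorC_fw_deriv hF hMo hw).2

lemma lorC_fwwbar_conjVec (hF : IsConformalImmersion F M) (hMo : IsOpen M) (hw : w ∈ M) :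
    lorC (fwwbar F w) (conjVec (fw F w)) = 0 := by
  rw [← conjVec_fwwbar hF hMo hw, lorC_conjVec, (lorC_fw_deriv hF hMo hw).2, map_zero]

lemma hasWirtinger_conformalFactor (hF : IsConformalImmersion F M) (hMo : IsOpen M)
    (humb : IsTotallyUmbilical F M) (hw : w ∈ M) :
    HasWirtinger (conformalFactor F) (umbilicFactor F w * conformalFactor F w)
      ((starRingEnd ℂ) (umbilicFactor F w) * conformalFactor F w) w := by
  have h := hasWirtingerVec_fw hF hMo hw
  refine (h.lorC h.conj).congr_deriv ?_ ?_
  · rw [conjVec_fwwbar hF hMo hw, lorC_fw_fwwbar hF hMo hw, fww_eq hF hMo humb hw,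
      lorC_smul_left, add_zero]; rfl
  · rw [lorC_fwwbar_conjVec hF hMo hw, fww_eq hF hMo humb hw, conjVec_smul,
      lorC_smul_right, zero_add]; rfl

lemma conformalFactor_smul_meanCurvature (hF : IsConformalImmersion F M) (hMo : IsOpen M)
    (hw : w ∈ M) : conformalFactor F w • toC (meanCurvature F w) = fwwbar F w := by
  funext j
  obtain ⟨s, hs, h⟩ := conformalFactor_eq_ofReal hF hw
  have hr : (starRingEnd ℂ) (fwwbar F w j) = fwwbar F w j :=
    congrFun (conjVec_fwwbar hF hMo hw) j
  have hre := Complex.conj_eq_iff_re.1 hr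
  have hs' : (s : ℂ) ≠ 0 := by exact_mod_cast hs.ne'
  have h' : lorC (fw F w) (conjVec (fw F w)) = s := h
  simp only [Pi.smul_apply, smul_eq_mul, toC, meanCurvature, h, h', Complex.ofReal_re]
  push_cast
  rw [hre]
  field_simp

lemma contDiffOn_lorC {x y : ℂ → Fin 4 → ℂ} (hx : ∀ j, ContDiffOn ℝ ∞ (fun z => x z j) M)
    (hy : ∀ j, ContDiffOn ℝ ∞ (fun z => y z j) M) :
    ContDiffOn ℝ ∞ (fun z => lorC (x z) (y z)) M := by
  unfold lorC
  exact (((((hx 0).mul (hy 0)).neg).add ((hx 1).mul (hy 1))).add ((hx 2).mul (hy 2))).add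
    ((hx 3).mul (hy 3))

lemma contDiffOn_conjVec_fw (hF : IsConformalImmersion F M) (hMo : IsOpen M) (j : Fin 4) :
    ContDiffOn ℝ ∞ (fun z => conjVec (fw F z) j) M :=
  (Complex.conjCLE : ℂ →L[ℝ] ℂ).contDiff.comp_contDiffOn (contDiffOn_fw hF hMo j)

lemma contDiffOn_conformalFactor (hF : IsConformalImmersion F M) (hMo : IsOpen M) :
    ContDiffOn ℝ ∞ (conformalFactor F) M :=
  contDiffOn_lorC (contDiffOn_fw hF hMo) (contDiffOn_conjVec_fw hF hMo)

lemma contDiffOn_umbilicFactor (hF : IsConformalImmersion F M) (hMo : IsOpen M) :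
    ContDiffOn ℝ ∞ (umbilicFactor F) M :=
  (contDiffOn_lorC (fun j => contDiffOn_dw (contDiffOn_fw hF hMo j) hMo)
    (contDiffOn_conjVec_fw hF hMo)).mul ((contDiffOn_conformalFactor hF hMo).inv
    fun _ hz => conformalFactor_ne_zero hF hz)

lemma contDiffOn_meanCurvature (hF : IsConformalImmersion F M) (hMo : IsOpen M) (j : Fin 4) :
    ContDiffOn ℝ ∞ (fun z => toC (meanCurvature F z) j) M := by
  refine ((contDiffOn_dwbar (contDiffOn_fw hF hMo j) hMo).mul
    ((contDiffOn_conformalFactor hF hMo).inv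
      fun _ hz => conformalFactor_ne_zero hF hz)).congr fun z hz => ?_
  have h := congrFun (conformalFactor_smul_meanCurvature hF hMo hz) j
  rw [Pi.smul_apply, smul_eq_mul] at h
  rw [Pi.inv_apply, eq_mul_inv_iff_mul_eq₀ (conformalFactor_ne_zero hF hz), mul_comm]
  exact h

lemma lorC_meanCurvature_fw (hF : IsConformalImmersion F M) (hMo : IsOpen M) (hw : w ∈ M) :
    lorC (toC (meanCurvature F w)) (fw F w) = 0 := by
  have h := (lorC_fw_deriv hF hMo hw).2
  rw [← conformalFactor_smul_meanCurvature hF hMo hw, lorC_smul_left] at h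
  exact (mul_eq_zero.1 h).resolve_left (conformalFactor_ne_zero hF hw)

lemma lorC_meanCurvature_conjVec (hF : IsConformalImmersion F M) (hMo : IsOpen M) (hw : w ∈ M) :
    lorC (toC (meanCurvature F w)) (conjVec (fw F w)) = 0 := by
  rw [← conjVec_toC, lorC_conjVec, lorC_meanCurvature_fw hF hMo hw, map_zero]

/-- On a totally umbilical surface `H_w` is a multiple of `f_w`, the factor being `-⟨H, H⟩`. -/
lemma hasWirtingerVec_meanCurvature (hF : IsConformalImmersion F M) (hMo : IsOpen M)
    (humb : IsTotallyUmbilical F M) (hw : w ∈ M) :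
    HasWirtingerVec (fun z => toC (meanCurvature F z))
      ((-(lor (meanCurvature F w) (meanCurvature F w) : ℂ)) • fw F w)
      ((-(lor (meanCurvature F w) (meanCurvature F w) : ℂ)) • conjVec (fw F w)) w := by
  have hρ := conformalFactor_ne_zero hF hw
  -- Equating `(κ f_w)_w̄` with `(ρH)_w`, where `ρ_w = κρ`, the terms `κρH` cancel and `ρ H_w = κ_w̄
  -- f_w` remains.
  set l : ℂ := dwbar (umbilicFactor F) w / conformalFactor F w with hl
  have hH : HasWirtingerVec (fun z => toC (meanCurvature F z)) (l • fw F w)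
      ((starRingEnd ℂ) l • conjVec (fw F w)) w := by
    intro j
    have h := hasWirtinger_of_contDiffOn (contDiffOn_meanCurvature hF hMo j) hMo hw
    have hp : dw (fun z => toC (meanCurvature F z) j) w = l * fw F w j := by
      have h1 : HasWirtinger (fun z => fwwbar F z j) _ _ w :=
        ((hasWirtinger_conformalFactor hF hMo humb hw).mul h).congr_on hMo hw fun z hz =>
          (congrFun (conformalFactor_smul_meanCurvature hF hMo hz) j).symm
      have h2 : HasWirtinger (fun z => fww F z j) _ _ w :=
        ((hasWirtinger_of_contDiffOn (contDiffOn_umbilicFactor hF hMo) hMo hw).mul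
          (hasWirtingerVec_fw hF hMo hw j)).congr_on hMo hw fun z hz => by
            rw [fww_eq hF hMo humb hz]; rfl
      have h3 : dwbar (fun z => fww F z j) w = dw (fun z => fwwbar F z j) w :=
        dwbar_dw_comm (contDiffOn_fw hF hMo j) hMo hw
      rw [h1.dw_eq, h2.dwbar_eq] at h3
      have h4 := congrFun (conformalFactor_smul_meanCurvature hF hMo hw) j
      rw [Pi.smul_apply, smul_eq_mul] at h4
      rw [hl, div_mul_eq_mul_div, eq_div_iff hρ]
      linear_combination -h3 - umbilicFactor F w * h4
    refine h.congr_deriv hp ?_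
    have h' := h.conj
    have hr : (fun z => (starRingEnd ℂ) (toC (meanCurvature F z) j)) =
        fun z => toC (meanCurvature F z) j := by funext z; simp [toC]
    rw [hr] at h'
    rw [h'.dwbar_eq, hp]
    simp [conjVec]
  -- The `w̄`-derivative of `⟨H, f_w⟩ = 0` reads `l̄ ρ + ρ⟨H, H⟩ = 0`, so `l` is real and equals
  -- `-⟨H, H⟩`.
  have h0 := (hH.lorC (hasWirtingerVec_fw hF hMo hw)).dwbar_eq.symm.trans
    ((HasWirtinger.const 0).congr_on hMo hw fun z hz =>
      lorC_meanCurvature_fw hF hMo hz).dwbar_eq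
  rw [← conformalFactor_smul_meanCurvature hF hMo hw, lorC_smul_left, lorC_smul_right,
    lorC_toC, lorC_comm (conjVec _)] at h0
  have h0' : conformalFactor F w * ((starRingEnd ℂ) l +
      (lor (meanCurvature F w) (meanCurvature F w) : ℂ)) = 0 := by
    rw [← h0, conformalFactor]; ring
  have h1 := eq_neg_of_add_eq_zero_left ((mul_eq_zero.1 h0').resolve_left hρ)
  have h2 : l = -(lor (meanCurvature F w) (meanCurvature F w) : ℂ) := by
    rw [← Complex.conj_conj l, h1]; simp
  rw [h1, h2] at hH
  exact hH

/-- `H` is normal while its derivatives are tangent. -/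
lemma lor_meanCurvature_constant (hF : IsConformalImmersion F M) (hMo : IsOpen M)
    (hMc : IsPreconnected M) (humb : IsTotallyUmbilical F M) {z : ℂ} (hz : z ∈ M) (hw : w ∈ M) :
    lor (meanCurvature F z) (meanCurvature F z) = lor (meanCurvature F w) (meanCurvature F w) := by
  have : ∀ w ∈ M, HasWirtinger
      (fun z => lorC (toC (meanCurvature F z)) (toC (meanCurvature F z))) 0 0 w := by
    intro w hw
    have h := hasWirtingerVec_meanCurvature hF hMo humb hw
    refine (h.lorC h).congr_deriv ?_ ?_
    · rw [lorC_comm, lorC_smul_right, lorC_meanCurvature_fw hF hMo hw]; ring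
    · rw [lorC_comm, lorC_smul_right, lorC_meanCurvature_conjVec hF hMo hw]; ring
  have h := constant_of_hasWirtinger_zero hMo hMc this hz hw
  simp only [lorC_toC] at h
  exact_mod_cast h

end immersion

/-! ### The triple cross product. -/

/-- The determinant of the minor of the `3 × 4` matrix with rows `x, y, z` on columns `i, j, k`. -/
def minor3 (x y z : Fin 4 → ℂ) (i j k : Fin 4) : ℂ :=
  x i * (y j * z k - y k * z j) - x j * (y i * z k - y k * z i) + x k * (y i * z j - y j * z i)

/-- The triple cross product of `ℂ⁴` with respect to the complex bilinear Lorentz product. -/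
def crossC (x y z : Fin 4 → ℂ) : Fin 4 → ℂ :=
  ![-minor3 x y z 1 2 3, -minor3 x y z 0 2 3, minor3 x y z 0 1 3, -minor3 x y z 0 1 2]

lemma lorC_crossC_left (x y z : Fin 4 → ℂ) : lorC (crossC x y z) x = 0 := by
  simp [lorC, crossC, minor3]; ring

/-- The Gram determinant; the minus sign comes from the signature. -/
lemma lorC_crossC_crossC (x y z : Fin 4 → ℂ) : lorC (crossC x y z) (crossC x y z) =
    -(lorC x x * (lorC y y * lorC z z - lorC y z ^ 2)
      - lorC x y * (lorC x y * lorC z z - lorC y z * lorC x z)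
      + lorC x z * (lorC x y * lorC y z - lorC y y * lorC x z)) := by
  simp [lorC, crossC, minor3]; ring

lemma crossC_swap (x y z : Fin 4 → ℂ) : crossC y x z = -crossC x y z := by
  funext j
  fin_cases j <;> simp [crossC, minor3] <;> ring

lemma conjVec_crossC (x y z : Fin 4 → ℂ) :
    conjVec (crossC x y z) = crossC (conjVec x) (conjVec y) (conjVec z) := by
  funext j
  fin_cases j <;> simp [crossC, minor3, conjVec]

lemma HasWirtinger.minor3 {x y z : ℂ → Fin 4 → ℂ} {p q p' q' p'' q'' : Fin 4 → ℂ} {w : ℂ}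
    (hx : HasWirtingerVec x p q w) (hy : HasWirtingerVec y p' q' w)
    (hz : HasWirtingerVec z p'' q'' w) (i j k : Fin 4) :
    HasWirtinger (fun u => minor3 (x u) (y u) (z u) i j k)
      (_root_.minor3 p (y w) (z w) i j k + _root_.minor3 (x w) p' (z w) i j k
        + _root_.minor3 (x w) (y w) p'' i j k)
      (_root_.minor3 q (y w) (z w) i j k + _root_.minor3 (x w) q' (z w) i j k
        + _root_.minor3 (x w) (y w) q'' i j k) w := by
  have h := (((hx i).mul (((hy j).mul (hz k)).sub ((hy k).mul (hz j)))).sub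
    ((hx j).mul (((hy i).mul (hz k)).sub ((hy k).mul (hz i))))).add
    ((hx k).mul (((hy i).mul (hz j)).sub ((hy j).mul (hz i))))
  exact h.congr_deriv (by simp only [_root_.minor3]; ring) (by simp only [_root_.minor3]; ring)

lemma HasWirtinger.neg {g : ℂ → ℂ} {p q w : ℂ} (h : HasWirtinger g p q w) :
    HasWirtinger (fun z => -g z) (-p) (-q) w := by
  have := (HasWirtinger.const 0).sub h
  simpa only [zero_sub] using this

lemma HasWirtinger.inv {g : ℂ → ℂ} {p q w : ℂ} (h : HasWirtinger g p q w) (hw : g w ≠ 0) :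
    HasWirtinger (fun z => (g z)⁻¹) (-p / g w ^ 2) (-q / g w ^ 2) w := by
  refine HasFDerivAt.congr_fderiv
    (((hasDerivAt_inv hw).hasFDerivAt.restrictScalars ℝ).comp w h) ?_
  ext z
  simp
  ring

lemma HasWirtingerVec.crossC {x y z : ℂ → Fin 4 → ℂ} {p q p' q' p'' q'' : Fin 4 → ℂ} {w : ℂ}
    (hx : HasWirtingerVec x p q w) (hy : HasWirtingerVec y p' q' w)
    (hz : HasWirtingerVec z p'' q'' w) :
    HasWirtingerVec (fun u => crossC (x u) (y u) (z u))
      (_root_.crossC p (y w) (z w) + _root_.crossC (x w) p' (z w)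
        + _root_.crossC (x w) (y w) p'')
      (_root_.crossC q (y w) (z w) + _root_.crossC (x w) q' (z w)
        + _root_.crossC (x w) (y w) q'') w := by
  have h := HasWirtinger.minor3 hx hy hz
  intro j
  fin_cases j
  · exact (h 1 2 3).neg.congr_deriv (by simp [_root_.crossC]; ring)
      (by simp [_root_.crossC]; ring)
  · exact (h 0 2 3).neg.congr_deriv (by simp [_root_.crossC]; ring)
      (by simp [_root_.crossC]; ring)
  · exact (h 0 1 3).congr_deriv (by simp [_root_.crossC]) (by simp [_root_.crossC])
  · exact (h 0 1 2).neg.congr_deriv (by simp [_root_.crossC]; ring)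
      (by simp [_root_.crossC]; ring)

/-! ### The constant normal vector. -/

section immersion

variable {F : ℂ → L4} {M : Set ℂ} {w : ℂ}

/-- The normal vector `φ × φ̄ × H`, with `φ = f_w`, divided by the conformal factor. -/
noncomputable def crossNormal (f : ℂ → L4) (w : ℂ) : Fin 4 → ℂ :=
  (Complex.I * (conformalFactor f w)⁻¹) •
    crossC (fw f w) (conjVec (fw f w)) (toC (meanCurvature f w))

/-- In the product rule for `φ × φ̄ × H` every term with a repeated direction drops out. Only `κ`
(respectively `κ̄`) times the product survives, and the derivative of `ρ⁻¹` cancels it. -/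
lemma hasWirtingerVec_crossNormal (hF : IsConformalImmersion F M) (hMo : IsOpen M)
    (humb : IsTotallyUmbilical F M) (hw : w ∈ M) :
    HasWirtingerVec (crossNormal F) 0 0 w := by
  have hρ := conformalFactor_ne_zero hF hw
  have h := hasWirtingerVec_fw hF hMo hw
  have hc := h.crossC h.conj (hasWirtingerVec_meanCurvature hF hMo humb hw)
  rw [conjVec_fwwbar hF hMo hw, ← conformalFactor_smul_meanCurvature hF hMo hw,
    fww_eq hF hMo humb hw, conjVec_smul] at hc
  intro j
  refine (((HasWirtinger.const Complex.I).mul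
    ((hasWirtinger_conformalFactor hF hMo humb hw).inv hρ)).mul (hc j)).congr_deriv ?_ ?_
  all_goals
    fin_cases j <;> simp [crossC, minor3] <;> field_simp <;> ring

/-- Conjugation swaps `φ` and `φ̄`; the factor `i` absorbs the resulting sign. -/
lemma conjVec_crossNormal (hF : IsConformalImmersion F M) (hw : w ∈ M) :
    conjVec (crossNormal F w) = crossNormal F w := by
  obtain ⟨s, hs, h⟩ := conformalFactor_eq_ofReal hF hw
  rw [crossNormal, conjVec_smul, conjVec_crossC, conjVec_conjVec, conjVec_toC, crossC_swap, h]
  simp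

lemma lorC_crossNormal_self (hF : IsConformalImmersion F M) (hMo : IsOpen M) (hw : w ∈ M) :
    lorC (crossNormal F w) (crossNormal F w) =
      -(lor (meanCurvature F w) (meanCurvature F w) : ℂ) := by
  have hρ := conformalFactor_ne_zero hF hw
  rw [crossNormal, lorC_smul_left, lorC_smul_right, lorC_crossC_crossC, hF.isotropic w hw,
    lorC_comm (fw F w) (toC _), lorC_meanCurvature_fw hF hMo hw,
    lorC_comm (conjVec _) (toC _), lorC_meanCurvature_conjVec hF hMo hw, lorC_toC]
  change _ * (_ * -(_ - conformalFactor F w * (conformalFactor F w * _ - _) + _)) = _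
  field_simp
  linear_combination (lor (meanCurvature F w) (meanCurvature F w) : ℂ) *
    conformalFactor F w ^ 2 * Complex.I_sq

/-- A totally umbilical surface lies in a hyperplane whose normal has norm `-⟨H, H⟩`. -/
lemma exists_constant_normal (hF : IsConformalImmersion F M) (hMo : IsOpen M)
    (hMc : IsPreconnected M) (humb : IsTotallyUmbilical F M) (hw : w ∈ M) :
    ∃ v : L4, lor v v = -lor (meanCurvature F w) (meanCurvature F w) ∧
      ∀ z ∈ M, lorC (toC v) (fw F z) = 0 := by
  have hv : toC (fun j => (crossNormal F w j).re) = crossNormal F w := by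
    funext j
    exact Complex.conj_eq_iff_re.1 (congrFun (conjVec_crossNormal hF hw) j)
  refine ⟨fun j => (crossNormal F w j).re, ?_, fun z hz => ?_⟩
  · have h := lorC_crossNormal_self hF hMo hw
    rw [← hv, lorC_toC] at h
    exact_mod_cast h
  · have hwz : crossNormal F w = crossNormal F z := by
      funext j
      exact constant_of_hasWirtinger_zero hMo hMc
        (fun u hu => hasWirtingerVec_crossNormal hF hMo humb hu j) hw hz
    rw [hv, hwz, crossNormal, lorC_smul_left, lorC_crossC_left, mul_zero]

/-- The `w̄`-derivative of `⟨v, f_w⟩ = 0` is `ρ⟨v, H⟩ = 0`. -/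
lemma lor_meanCurvature_of_orthogonal (hF : IsConformalImmersion F M) (hMo : IsOpen M)
    {v : L4} (hv : ∀ z ∈ M, lorC (toC v) (fw F z) = 0) (hw : w ∈ M) :
    lor v (meanCurvature F w) = 0 := by
  have h := ((HasWirtingerVec.const (toC v) w).lorC (hasWirtingerVec_fw hF hMo hw)).dwbar_eq
  have h0 := ((HasWirtinger.const (w := w) 0).congr_on hMo hw hv).dwbar_eq
  rw [h0, lorC_zero_left, zero_add, ← conformalFactor_smul_meanCurvature hF hMo hw,
    lorC_smul_right, lorC_toC] at h
  exact_mod_cast (mul_eq_zero.1 h.symm).resolve_left (conformalFactor_ne_zero hF hw)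

lemma lor_constant_of_orthogonal (hF : IsConformalImmersion F M) (hMo : IsOpen M)
    (hMc : IsPreconnected M) {v : L4} (hv : ∀ z ∈ M, lorC (toC v) (fw F z) = 0)
    {z : ℂ} (hz : z ∈ M) (hw : w ∈ M) : lor v (F z) = lor v (F w) := by
  have : ∀ z ∈ M, HasWirtinger (fun u => lorC (toC v) (toC (F u))) 0 0 z := by
    intro z hz
    refine ((HasWirtingerVec.const (toC v) z).lorC
      (hasWirtingerVec_toC hF hMo hz)).congr_deriv ?_ ?_
    · rw [hv z hz, lorC_zero_left, zero_add]
    · rw [lorC_zero_left, zero_add, ← conjVec_toC, lorC_conjVec, hv z hz, map_zero]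
  have h := constant_of_hasWirtinger_zero hMo hMc this hz hw
  simp only [lorC_toC] at h
  exact_mod_cast h

lemma orthogonal_of_lor_constant (hF : IsConformalImmersion F M) (hMo : IsOpen M)
    {v : L4} {c : ℝ} (hv : ∀ z ∈ M, lor v (F z) = c) (hw : w ∈ M) :
    lorC (toC v) (fw F w) = 0 := by
  have h := ((HasWirtingerVec.const (toC v) w).lorC (hasWirtingerVec_toC hF hMo hw)).dw_eq
  have h0 := ((HasWirtinger.const (w := w) (c : ℂ)).congr_on hMo hw
    (k := fun z => lorC (toC v) (toC (F z))) fun z hz => by rw [lorC_toC, hv z hz]).dw_eq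
  rw [h0, lorC_zero_left, zero_add] at h
  exact h.symm

end immersion

/-! ### The mean curvature vector is not null. -/

section immersion

variable {F : ℂ → L4} {M : Set ℂ} {w : ℂ}

/-- Orthogonality of a real vector to `f_w`, written in terms of `a(f)` and `b(f)`. -/
lemma data_eq_of_orthogonal (hF : IsConformalImmersion F M) (hden : ∀ w ∈ M, den F w ≠ 0)
    {n : L4} (hw : w ∈ M) (hn : lorC (toC n) (fw F w) = 0) :
    ((n 1 : ℂ) + Complex.I * n 2) + aMap F w * bMap F w * ((n 1 : ℂ) - Complex.I * n 2)
      = aMap F w * ((n 0 : ℂ) - n 3) + bMap F w * ((n 0 : ℂ) + n 3) := by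
  have hd := hden w hw
  have hiso := hF.isotropic w hw
  have hA : aMap F w * den F w = fw F w 0 + fw F w 3 := div_mul_cancel₀ _ hd
  have hB : bMap F w * den F w = fw F w 0 - fw F w 3 := div_mul_cancel₀ _ hd
  have hD : den F w = fw F w 1 - Complex.I * fw F w 2 := rfl
  -- Isotropy is `(f₀ + f₃)(f₀ - f₃) = (f₁ + i f₂)(f₁ - i f₂)` for the components of `f_w`.
  have hE : aMap F w * bMap F w * den F w = fw F w 1 + Complex.I * fw F w 2 := by
    apply mul_right_cancel₀ hd
    have : aMap F w * bMap F w * den F w * den F w =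
        (fw F w 0 + fw F w 3) * (fw F w 0 - fw F w 3) := by rw [← hA, ← hB]; ring
    rw [this, hD]
    simp only [lorC] at hiso
    linear_combination -hiso + fw F w 2 ^ 2 * Complex.I_sq
  apply mul_right_cancel₀ hd
  simp only [lorC, toC] at hn
  have e1 : ((n 1 : ℂ) + Complex.I * n 2) * den F w +
      ((n 1 : ℂ) - Complex.I * n 2) * (aMap F w * bMap F w * den F w) -
      ((n 0 : ℂ) - n 3) * (aMap F w * den F w) - ((n 0 : ℂ) + n 3) * (bMap F w * den F w) = 0 := by
    rw [hA, hB, hE, hD]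
    linear_combination 2 * hn - 2 * (n 2 : ℂ) * fw F w 2 * Complex.I_sq
  linear_combination e1

/-- The conjugated factors are analytic, and analytic functions on a connected open set have no zero
divisors. -/
lemma constant_of_mul_eq_zero {a b : ℂ → ℂ} (hMo : IsOpen M) (hMc : IsPreconnected M)
    (ha : IsAntiHolomorphicOn a M) (hb : IsAntiHolomorphicOn b M) {c d z : ℂ} (hz : z ≠ 0)
    (h : ∀ w ∈ M, (a w * z - c) * (b w * z - d) = 0) : IsConstantOn a M ∨ IsConstantOn b M := by
  have key : ∀ {g : ℂ → ℂ} {e : ℂ}, IsAntiHolomorphicOn g M →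
      AnalyticOnNhd ℂ (fun w => (starRingEnd ℂ) (g w * z - e)) M := by
    intro g e hg
    refine DifferentiableOn.analyticOnNhd ?_ hMo
    simp only [map_sub, map_mul]
    exact (hg.mul_const _).sub_const _
  have hconst : ∀ {g : ℂ → ℂ} {e : ℂ}, (∀ w ∈ M, (starRingEnd ℂ) (g w * z - e) = 0) →
      IsConstantOn g M := by
    intro g e hg
    refine ⟨e / z, fun w hw => ?_⟩
    have h1 := (map_eq_zero (starRingEnd ℂ)).1 (hg w hw)
    rw [eq_div_iff hz]
    linear_combination h1
  rcases AnalyticOnNhd.eq_zero_or_eq_zero_of_mul_eq_zero (key ha (e := c)) (key hb (e := d))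
    (fun w hw => by rw [← map_mul, h w hw, map_zero]) hMc with h1 | h1
  · exact Or.inl (hconst h1)
  · exact Or.inr (hconst h1)

/-- With `z = n₁ - i n₂`, nullity of `n` makes the orthogonality relation, multiplied by `z`, factor
as `(az - (n₀ + n₃))(bz - (n₀ - n₃)) = 0`. If `z = 0`, one of `n₀ ± n₃` vanishes and the other does
not, so the linear relation left over forces `a = 0` or `b = 0`. -/
lemma data_constant_of_null_normal (hF : IsConformalImmersion F M) (hMo : IsOpen M)
    (hMc : IsPreconnected M) (hden : ∀ w ∈ M, den F w ≠ 0)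
    (ha : IsAntiHolomorphicOn (aMap F) M) (hb : IsAntiHolomorphicOn (bMap F) M)
    {n : L4} (hn0 : n ≠ 0) (hnull : lor n n = 0)
    (hn : ∀ w ∈ M, lorC (toC n) (fw F w) = 0) :
    IsConstantOn (aMap F) M ∨ IsConstantOn (bMap F) M := by
  have hnull' : ((n 1 : ℂ) + Complex.I * n 2) * ((n 1 : ℂ) - Complex.I * n 2) =
      ((n 0 : ℂ) + n 3) * ((n 0 : ℂ) - n 3) := by
    have : (lor n n : ℂ) = 0 := by exact_mod_cast hnull
    simp only [lor] at this
    push_cast at this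
    linear_combination this - (n 2 : ℂ) ^ 2 * Complex.I_sq
  have hdata := fun w hw => data_eq_of_orthogonal hF hden hw (hn w hw)
  by_cases hz : (n 1 : ℂ) - Complex.I * n 2 = 0
  · have h1 : n 1 = 0 := by simpa using congrArg Complex.re hz
    have h2 : n 2 = 0 := by simpa using congrArg Complex.im hz
    simp only [h1, h2, Complex.ofReal_zero, mul_zero, add_zero, sub_zero] at hdata hnull'
    rcases mul_eq_zero.1 hnull'.symm with h3 | h3
    · left
      refine ⟨0, fun w hw => ?_⟩
      have h4 := hdata w hw
      rw [h3, mul_zero, add_zero] at h4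
      refine (mul_eq_zero.1 h4.symm).resolve_right fun h5 => hn0 ?_
      have h03 : (n 0 : ℂ) = 0 := by linear_combination (h3 + h5) / 2
      have h33 : (n 3 : ℂ) = 0 := by linear_combination (h3 - h5) / 2
      funext j
      fin_cases j
      exacts [by exact_mod_cast h03, h1, h2, by exact_mod_cast h33]
    · right
      refine ⟨0, fun w hw => ?_⟩
      have h4 := hdata w hw
      rw [h3, mul_zero, zero_add] at h4
      refine (mul_eq_zero.1 h4.symm).resolve_right fun h5 => hn0 ?_
      have h03 : (n 0 : ℂ) = 0 := by linear_combination (h3 + h5) / 2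
      have h33 : (n 3 : ℂ) = 0 := by linear_combination (h5 - h3) / 2
      funext j
      fin_cases j
      exacts [by exact_mod_cast h03, h1, h2, by exact_mod_cast h33]
  · refine constant_of_mul_eq_zero hMo hMc ha hb hz (c := (n 0 : ℂ) + n 3)
      (d := (n 0 : ℂ) - n 3) fun w hw => ?_
    linear_combination ((n 1 : ℂ) - Complex.I * n 2) * hdata w hw - hnull'

/-- If `f_{w w̄} = 0` then `f_w` is holomorphic, so the anti-holomorphic quotient `a` is holomorphic
too. -/
lemma aMap_constant_of_harmonic (hF : IsConformalImmersion F M) (hMo : IsOpen M)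
    (hMc : IsConnected M) (hden : ∀ w ∈ M, den F w ≠ 0)
    (ha : IsAntiHolomorphicOn (aMap F) M) (h0 : ∀ w ∈ M, fwwbar F w = 0) :
    IsConstantOn (aMap F) M := by
  obtain ⟨w₀, hw₀⟩ := hMc.nonempty
  refine ⟨aMap F w₀, fun w hw => constant_of_hasWirtinger_zero hMo hMc.isPreconnected
    (fun w hw => ?_) hw hw₀⟩
  have h1 := (hasWirtinger_of_hasDerivAt
    ((ha.differentiableAt (hMo.mem_nhds hw)).hasDerivAt)).conj
  simp only [Complex.conj_conj, map_zero] at h1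
  refine h1.congr_deriv rfl ?_
  have hf := hasWirtingerVec_fw hF hMo hw
  have hd : HasWirtinger (den F) _ _ w :=
    (hf 1).sub ((HasWirtinger.const Complex.I).mul (hf 2))
  have h2 := ((h1.mul hd).congr_on hMo hw (k := fun z => fw F z 0 + fw F z 3)
    fun z hz => (div_mul_cancel₀ _ (hden z hz)).symm).dwbar_eq
  rw [((hf 0).add (hf 3)).dwbar_eq, h0 w hw] at h2
  simp only [Pi.zero_apply, mul_zero, zero_mul, add_zero, sub_zero] at h2
  exact (mul_eq_zero.1 h2.symm).resolve_right (hden w hw)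

/-- The mean curvature vector of a totally umbilical surface with non-constant data is not null. -/
lemma lor_meanCurvature_ne_zero (hF : IsConformalImmersion F M) (hMo : IsOpen M)
    (hMc : IsConnected M) (humb : IsTotallyUmbilical F M) (hden : ∀ w ∈ M, den F w ≠ 0)
    (ha : IsAntiHolomorphicOn (aMap F) M) (hb : IsAntiHolomorphicOn (bMap F) M)
    (hac : ¬ IsConstantOn (aMap F) M) (hbc : ¬ IsConstantOn (bMap F) M) (hw : w ∈ M) :
    lor (meanCurvature F w) (meanCurvature F w) ≠ 0 := by
  intro h0
  have hH : ∀ z ∈ M, meanCurvature F z = meanCurvature F w := by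
    intro z hz
    funext j
    have : toC (meanCurvature F z) j = toC (meanCurvature F w) j :=
      constant_of_hasWirtinger_zero hMo hMc.isPreconnected
      (g := fun u => toC (meanCurvature F u) j) (fun u hu => by
        have h := hasWirtingerVec_meanCurvature hF hMo humb hu j
        rw [lor_meanCurvature_constant hF hMo hMc.isPreconnected humb hu hw, h0] at h
        simpa using h) hz hw
    exact Complex.ofReal_injective this
  by_cases hn : meanCurvature F w = 0
  · refine hac (aMap_constant_of_harmonic hF hMo hMc hden ha fun z hz => ?_)
    rw [← conformalFactor_smul_meanCurvature hF hMo hz, hH z hz, hn]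
    funext j
    simp [toC]
  · refine (data_constant_of_null_normal hF hMo hMc.isPreconnected hden ha hb hn h0
      fun z hz => ?_).elim hac hbc
    rw [← hH z hz]
    exact lorC_meanCurvature_fw hF hMo hz

/-! ### The center, time orientation and translation into the light cone. -/

/-- The center `f + H / ⟨H, H⟩` of a totally umbilical surface is constant. -/
lemma exists_center (hF : IsConformalImmersion F M) (hMo : IsOpen M)
    (hMc : IsPreconnected M) (humb : IsTotallyUmbilical F M) (hw : w ∈ M)
    {s : ℝ} (hs : s = lor (meanCurvature F w) (meanCurvature F w)) (hs0 : s ≠ 0) :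
    ∃ p : L4, ∀ z ∈ M, F z = p - s⁻¹ • meanCurvature F z := by
  refine ⟨F w + s⁻¹ • meanCurvature F w, fun z hz => ?_⟩
  funext j
  have h : ∀ u ∈ M, HasWirtinger (fun u => toC (F u) j + (s⁻¹ : ℂ) * toC (meanCurvature F u) j)
      0 0 u := by
    intro u hu
    have hs1 := lor_meanCurvature_constant hF hMo hMc humb hu hw
    have hs' : (s : ℂ) ≠ 0 := by exact_mod_cast hs0
    refine ((hasWirtingerVec_toC hF hMo hu j).add ((HasWirtinger.const (s⁻¹ : ℂ)).mul
      (hasWirtingerVec_meanCurvature hF hMo humb hu j))).congr_deriv ?_ ?_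
    all_goals
      rw [hs1, ← hs]
      simp only [Pi.smul_apply, smul_eq_mul]
      field_simp
      ring
  have h1 := constant_of_hasWirtinger_zero hMo hMc h hz hw
  simp only [toC] at h1
  have h2 : F z j + s⁻¹ * meanCurvature F z j = F w j + s⁻¹ * meanCurvature F w j := by
    exact_mod_cast h1
  simp only [Pi.sub_apply, Pi.add_apply, Pi.smul_apply, smul_eq_mul]
  linarith

end immersion

lemma lor_comm (x y : L4) : lor x y = lor y x := by simp only [lor]; ring

lemma lor_add_left (x y z : L4) : lor (x + y) z = lor x z + lor y z := by
  simp only [lor, Pi.add_apply]; ring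

lemma lor_sub_left (x y z : L4) : lor (x - y) z = lor x z - lor y z := by
  simp only [lor, Pi.sub_apply]; ring

lemma lor_neg_left (x y : L4) : lor (-x) y = -lor x y := by
  simp only [lor, Pi.neg_apply]; ring

lemma lor_smul_left (c : ℝ) (x y : L4) : lor (c • x) y = c * lor x y := by
  simp only [lor, Pi.smul_apply, smul_eq_mul]; ring

lemma lor_add_right (x y z : L4) : lor x (y + z) = lor x y + lor x z := by
  simp only [lor, Pi.add_apply]; ring

lemma lor_sub_right (x y z : L4) : lor x (y - z) = lor x y - lor x z := by
  simp only [lor, Pi.sub_apply]; ring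

lemma lor_neg_right (x y : L4) : lor x (-y) = -lor x y := by
  simp only [lor, Pi.neg_apply]; ring

lemma lor_smul_right (c : ℝ) (x y : L4) : lor x (c • y) = c * lor x y := by
  simp only [lor, Pi.smul_apply, smul_eq_mul]; ring

lemma time_ne_zero_of_lor_neg {x : L4} (h : lor x x < 0) : x 0 ≠ 0 := by
  intro h0
  simp only [lor, h0] at h
  nlinarith [sq_nonneg (x 1), sq_nonneg (x 2), sq_nonneg (x 3)]

/-- Two causal vectors with negative product have the same time orientation. -/
lemma time_pos_of_lor_neg {x y : L4} (hx : lor x x ≤ 0) (hy : lor y y ≤ 0) (hy0 : 0 < y 0)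
    (hxy : lor x y < 0) : 0 < x 0 := by
  by_contra! hx0
  simp only [lor] at hx hy hxy
  have h1 : x 0 * y 0 ≤ 0 := mul_nonpos_of_nonpos_of_nonneg hx0 hy0.le
  -- If `x₀ ≤ 0`, the spatial product `c` lies below `x₀y₀ ≤ 0`, so `c²` exceeds `(x₀y₀)²`, against
  -- Cauchy–Schwarz for causal vectors.
  set c := x 1 * y 1 + x 2 * y 2 + x 3 * y 3 with hc
  have h2 : c < x 0 * y 0 := by rw [hc]; linarith
  have h3 : (x 0 * y 0) ^ 2 < c ^ 2 := by nlinarith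
  have h4 : c ^ 2 ≤ (x 1 ^ 2 + x 2 ^ 2 + x 3 ^ 2) * (y 1 ^ 2 + y 2 ^ 2 + y 3 ^ 2) := by
    rw [hc]
    nlinarith [sq_nonneg (x 1 * y 2 - x 2 * y 1), sq_nonneg (x 1 * y 3 - x 3 * y 1),
      sq_nonneg (x 2 * y 3 - x 3 * y 2)]
  have h5 : (x 1 ^ 2 + x 2 ^ 2 + x 3 ^ 2) * (y 1 ^ 2 + y 2 ^ 2 + y 3 ^ 2) ≤ x 0 ^ 2 * y 0 ^ 2 :=
    mul_le_mul (by nlinarith) (by nlinarith) (by positivity) (by positivity)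
  nlinarith

lemma pos_of_pos_of_ne_zero {M : Set ℂ} {g : ℂ → ℝ} (hMc : IsPreconnected M)
    (hg : ContinuousOn g M) (h0 : ∀ z ∈ M, g z ≠ 0) {w : ℂ} (hw : w ∈ M) (hgw : 0 < g w) :
    ∀ z ∈ M, 0 < g z := by
  intro z hz
  by_contra! hgz
  obtain ⟨u, hu, hu0⟩ := hMc.intermediate_value hz hw hg ⟨hgz, hgw.le⟩
  exact h0 u hu hu0

section immersion

variable {F : ℂ → L4} {M : Set ℂ} {w : ℂ}

lemma continuousOn_meanCurvature (hF : IsConformalImmersion F M) (hMo : IsOpen M) (j : Fin 4) :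
    ContinuousOn (fun z => meanCurvature F z j) M :=
  Complex.continuous_re.comp_continuousOn (contDiffOn_meanCurvature hF hMo j).continuousOn

lemma fw_add_const (F : ℂ → L4) (c : L4) : fw (fun z => F z + c) = fw F := by
  funext w j
  simp only [fw, dw, Pi.add_apply, Complex.ofReal_add, fderiv_add_const]

lemma IsConformalImmersion.add_const (hF : IsConformalImmersion F M) (c : L4) :
    IsConformalImmersion (fun z => F z + c) M where
  smooth := hF.smooth.add contDiffOn_const
  immersion w hw := by
    rw [fderiv_add_const]; exact hF.immersion w hw
  isotropic := by rw [fw_add_const]; exact hF.isotropic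
  spacelike := by rw [fw_add_const]; exact hF.spacelike

lemma sameData_add_const (F : ℂ → L4) (c : L4) (M : Set ℂ) :
    SameData (fun z => F z + c) F M := fun w _ => by
  simp only [aMap, bMap, muMap, den, fw_add_const, and_self]

lemma lor_lightCone_shift {H v : L4} {s : ℝ} (hs : s ≠ 0) (hH : lor H H = s) (hv : lor v v = -s)
    (hvH : lor v H = 0) :
    lor (s⁻¹ • (v - H)) (s⁻¹ • (v - H)) = 0 ∧ lor (s⁻¹ • (v - H)) v = -1 ∧
      lor (s⁻¹ • (v - H)) H = -1 := by
  have hHv : lor H v = 0 := by rw [lor_comm]; exact hvH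
  simp only [lor_smul_left, lor_smul_right, lor_sub_left, lor_sub_right, hH, hv, hvH, hHv]
  refine ⟨by ring, ?_, ?_⟩ <;> field_simp <;> ring

/-- For `s < 0` the timelike vector is `H`, whose time direction is fixed and dictates the cone. For
`s > 0` it is the constant normal, whose sign is free, so the future cone can always be reached. -/
lemma exists_lightCone_translate (hF : IsConformalImmersion F M)
    (hMo : IsOpen M) (hMc : IsConnected M) (humb : IsTotallyUmbilical F M) (hw : w ∈ M)
    {s : ℝ} (hs : s = lor (meanCurvature F w) (meanCurvature F w)) (hs0 : s ≠ 0) :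
    ((0 < s ∨ 0 < meanCurvature F w 0) →
      ∃ f : ℂ → L4, IsConformalImmersion f M ∧ Set.MapsTo f M futureCone ∧ SameData f F M) ∧
    ((s < 0 ∧ meanCurvature F w 0 < 0) →
      ∃ f : ℂ → L4, IsConformalImmersion f M ∧ Set.MapsTo f M pastCone ∧ SameData f F M) := by
  obtain ⟨p, hp⟩ := exists_center hF hMo hMc.isPreconnected humb hw hs hs0
  obtain ⟨v, hv, hvF⟩ := exists_constant_normal hF hMo hMc.isPreconnected humb hw
  rw [← hs] at hv
  have hHs : ∀ z ∈ M, lor (meanCurvature F z) (meanCurvature F z) = s := fun z hz =>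
    (lor_meanCurvature_constant hF hMo hMc.isPreconnected humb hz hw).trans hs.symm
  have hvH : ∀ z ∈ M, lor v (meanCurvature F z) = 0 := fun z hz =>
    lor_meanCurvature_of_orthogonal hF hMo hvF hz
  have key : ∀ u : L4, lor u u = -s → (∀ z ∈ M, lor u (meanCurvature F z) = 0) → ∀ z ∈ M,
      lor (F z + (s⁻¹ • u - p)) (F z + (s⁻¹ • u - p)) = 0 ∧ lor (F z + (s⁻¹ • u - p)) u = -1 ∧
      lor (F z + (s⁻¹ • u - p)) (meanCurvature F z) = -1 := by
    intro u hu huH z hz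
    have h1 : F z + (s⁻¹ • u - p) = s⁻¹ • (u - meanCurvature F z) := by
      rw [hp z hz]; module
    rw [h1]
    exact lor_lightCone_shift hs0 (hHs z hz) hu (huH z hz)
  have htime : s < 0 → ∀ z ∈ M, meanCurvature F z 0 ≠ 0 := fun hneg z hz =>
    time_ne_zero_of_lor_neg (by rw [hHs z hz]; exact hneg)
  refine ⟨fun hcase => ?_, fun ⟨hneg, hpast⟩ => ?_⟩
  · rcases lt_or_gt_of_ne hs0 with hneg | hpos
    · have hfut := pos_of_pos_of_ne_zero hMc.isPreconnected
        (continuousOn_meanCurvature hF hMo 0) (htime hneg) hw (hcase.resolve_left hneg.not_gt)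
      refine ⟨fun z => F z + (s⁻¹ • v - p), hF.add_const _, fun z hz => ?_,
        sameData_add_const _ _ _⟩
      obtain ⟨h1, -, h2⟩ := key v hv hvH z hz
      exact ⟨h1, time_pos_of_lor_neg h1.le (by rw [hHs z hz]; exact hneg.le) (hfut z hz)
        (by rw [h2]; norm_num)⟩
    · have hu : ∃ u : L4, lor u u = -s ∧ (∀ z ∈ M, lor u (meanCurvature F z) = 0) ∧ 0 < u 0 := by
        have h0 : v 0 ≠ 0 := time_ne_zero_of_lor_neg (by rw [hv]; linarith)
        rcases lt_or_gt_of_ne h0 with h | h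
        · refine ⟨-v, by rw [lor_neg_left, lor_neg_right, neg_neg, hv], fun z hz => ?_,
            by simpa using h⟩
          rw [lor_neg_left, hvH z hz, neg_zero]
        · exact ⟨v, hv, hvH, h⟩
      obtain ⟨u, hu, huH, hu0⟩ := hu
      refine ⟨fun z => F z + (s⁻¹ • u - p), hF.add_const _, fun z hz => ?_,
        sameData_add_const _ _ _⟩
      obtain ⟨h1, h2, -⟩ := key u hu huH z hz
      exact ⟨h1, time_pos_of_lor_neg h1.le (by rw [hu]; linarith) hu0 (by rw [h2]; norm_num)⟩
  · have hpast' := pos_of_pos_of_ne_zero (g := fun z => -meanCurvature F z 0) hMc.isPreconnected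
      (continuousOn_meanCurvature hF hMo 0).neg (fun z hz => neg_ne_zero.2 (htime hneg z hz)) hw
      (neg_pos.2 hpast)
    refine ⟨fun z => F z + (s⁻¹ • v - p), hF.add_const _, fun z hz => ?_,
      sameData_add_const _ _ _⟩
    obtain ⟨h1, -, h2⟩ := key v hv hvH z hz
    have h3 := time_pos_of_lor_neg (x := -(F z + (s⁻¹ • v - p))) (y := -meanCurvature F z)
      (by rw [lor_neg_left, lor_neg_right, neg_neg, h1])
      (by rw [lor_neg_left, lor_neg_right, neg_neg, hHs z hz]; exact hneg.le)
      (hpast' z hz) (by rw [lor_neg_left, lor_neg_right, neg_neg, h2]; norm_num)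
    exact ⟨h1, neg_pos.1 h3⟩

end immersion

/-! ### The surface is open in its quadric. -/

/-- A vector orthogonal to a basis consisting of a hyperbolic pair `x, y` and two further mutually
orthogonal non-null vectors vanishes. -/
lemma eq_zero_of_orthogonal {x y z u d : Fin 4 → ℂ} (hxx : lorC x x = 0) (hyy : lorC y y = 0)
    (hxy : lorC x y ≠ 0) (hzx : lorC z x = 0) (hzy : lorC z y = 0) (hux : lorC u x = 0)
    (huy : lorC u y = 0) (huz : lorC u z = 0) (hzz : lorC z z ≠ 0) (huu : lorC u u ≠ 0)
    (hdx : lorC d x = 0) (hdy : lorC d y = 0) (hdz : lorC d z = 0) (hdu : lorC d u = 0) :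
    d = 0 := by
  let A : Matrix (Fin 4) (Fin 4) ℂ := Matrix.of ![x, y, z, u]
  -- `B` is the metric times the transpose of `A`, so `A * B` is the Gram matrix of the four
  -- vectors.
  let B : Matrix (Fin 4) (Fin 4) ℂ := Matrix.of fun i j => if i = 0 then -A j i else A j i
  have hG : A * B = !![0, lorC x y, 0, 0; lorC x y, 0, 0, 0; 0, 0, lorC z z, 0;
      0, 0, 0, lorC u u] := by
    simp only [lorC] at *
    ext i j
    fin_cases i <;> fin_cases j <;>
      simp [A, B, Matrix.mul_apply, Fin.sum_univ_four] <;> grind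
  have hdet : (A * B).det ≠ 0 := by
    have : (A * B).det = -(lorC x y * lorC x y * lorC z z * lorC u u) := by
      rw [hG]
      simp [Matrix.det_succ_row_zero, Fin.sum_univ_succ, Fin.succAbove]
      ring
    rw [this, neg_ne_zero]
    exact mul_ne_zero (mul_ne_zero (mul_ne_zero hxy hxy) hzz) huu
  rw [Matrix.det_mul] at hdet
  have h0 : Matrix.vecMul d B = 0 := by
    simp only [lorC] at *
    funext j
    fin_cases j <;> simp [A, B, Matrix.vecMul, dotProduct, Fin.sum_univ_four] <;> grind
  exact Matrix.eq_zero_of_vecMul_eq_zero (right_ne_zero_of_mul hdet) h0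

lemma toC_injective : Function.Injective toC := fun x y h => by
  funext j
  exact Complex.ofReal_injective (congrFun h j)

section immersion

variable {F : ℂ → L4} {M : Set ℂ} {w : ℂ}

/-- A real vector orthogonal to the tangent plane and to one vector `u` of an orthogonal basis
`u, v` of the normal plane is a multiple of the other one. -/
lemma eq_smul_of_orthogonal (hF : IsConformalImmersion F M) (hw : w ∈ M) {u v d : L4}
    (hu : lorC (toC u) (fw F w) = 0) (hv : lorC (toC v) (fw F w) = 0)
    (hd : lorC (toC d) (fw F w) = 0) (huv : lor u v = 0) (huu : lor u u ≠ 0) (hvv : lor v v ≠ 0)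
    (hdu : lor d u = 0) : d = (lor d v / lor v v) • v := by
  have hconj : ∀ e : L4, lorC (toC e) (fw F w) = 0 → lorC (toC e) (conjVec (fw F w)) = 0 := by
    intro e he
    rw [← conjVec_toC, lorC_conjVec, he, map_zero]
  set e := d - (lor d v / lor v v) • v with he
  have hew : lorC (toC e) (fw F w) = 0 := by
    have : lorC (toC e) (fw F w) =
        lorC (toC d) (fw F w) - ((lor d v / lor v v : ℝ) : ℂ) * lorC (toC v) (fw F w) := by
      simp only [he, lorC, toC, Pi.sub_apply, Pi.smul_apply, smul_eq_mul]
      push_cast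
      ring
    rw [this, hd, hv, mul_zero, sub_zero]
  have h0 : toC e = 0 := by
    refine eq_zero_of_orthogonal (x := fw F w) (y := conjVec (fw F w)) (z := toC u) (u := toC v)
      (hF.isotropic w hw) (by rw [lorC_conjVec, hF.isotropic w hw, map_zero])
      (conformalFactor_ne_zero hF hw) hu (hconj u hu) hv (hconj v hv) ?_ ?_ ?_ hew (hconj e hew)
      ?_ ?_ <;> rw [lorC_toC] <;> norm_cast
    · rw [lor_comm, huv]
    · rw [he, lor_sub_left, lor_smul_left, hdu, lor_comm v u, huv, mul_zero, sub_zero]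
    · rw [he, lor_sub_left, lor_smul_left, div_mul_cancel₀ _ hvv, sub_self]
  have h1 : e = 0 := toC_injective (h0.trans (by funext j; simp [toC]))
  exact sub_eq_zero.1 h1

lemma continuous_lor_right (x : L4) : Continuous fun y => lor y x := by
  unfold lor; fun_prop

/-- Near a point of a totally umbilical surface, the sphere of its hyperplane that contains the
surface consists of points of the surface. -/
lemma exists_isOpen_inter_subset_image (hF : IsConformalImmersion F M) (hMo : IsOpen M)
    {s : ℝ} (hs0 : s ≠ 0)
    (hs : ∀ z ∈ M, lor (meanCurvature F z) (meanCurvature F z) = s)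
    {p : L4} (hp : ∀ z ∈ M, F z = p - s⁻¹ • meanCurvature F z) {v : L4} (hvv : lor v v ≠ 0)
    (hv : ∀ z ∈ M, lorC (toC v) (fw F z) = 0) (hw : w ∈ M) :
    ∃ U : Set L4, IsOpen U ∧ F w ∈ U ∧ ∀ x ∈ U, lor (x - p) v = 0 →
      lor (x - p) (x - p) = s⁻¹ → x ∈ F '' M := by
  set H := meanCurvature F w with hH
  have hvH : ∀ z ∈ M, lor v (meanCurvature F z) = 0 := fun z hz =>
    lor_meanCurvature_of_orthogonal hF hMo hv hz
  have hFp : ∀ z ∈ M, F z - p = -(s⁻¹ • meanCurvature F z) := fun z hz => by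
    rw [hp z hz]; module
  -- A complex-valued projection along the normal plane at `w`: its single equation controls both
  -- tangent directions.
  let π : L4 → ℂ := fun x => lorC (toC x) (conjVec (fw F w))
  have hπ : Continuous π := by
    simp only [π, lorC, toC]; fun_prop
  -- A line parallel to `H` can meet the quadric twice, at values of `⟨· - p, H⟩` that sum to zero;
  -- this half-space retains only one intersection.
  let V : Set L4 := {x | lor (x - p) H < 0}
  have hVo : IsOpen V := by
    have : Continuous fun x : L4 => lor (x - p) H :=
      (continuous_lor_right H).comp (continuous_id.sub continuous_const)
    exact isOpen_lt this continuous_const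
  have hwV : F w ∈ V := by
    simp only [V, Set.mem_ofPred_eq]
    rw [hFp w hw, lor_neg_left, lor_smul_left, ← hH, hs w hw, inv_mul_cancel₀ hs0]
    norm_num
  have hcont : ContinuousAt F w := (hF.smooth.contDiffAt (hMo.mem_nhds hw)).continuousAt
  have hρ := conformalFactor_ne_zero hF hw
  -- The differential is multiplication by `ρ ≠ 0`, so `π ∘ F` is open at `w`.
  have hder : HasWirtinger (fun z => π (F z)) (conformalFactor F w) 0 w := by
    refine ((hasWirtingerVec_toC hF hMo hw).lorC
      (HasWirtingerVec.const (conjVec (fw F w)) w)).congr_deriv ?_ ?_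
    · rw [lorC_zero_right, add_zero]; rfl
    · rw [lorC_zero_right, add_zero, lorC_conjVec, hF.isotropic w hw, map_zero]
  have hsmooth : ContDiffAt ℝ ∞ (fun z => π (F z)) w := by
    refine (contDiffOn_lorC (contDiffOn_toC hF) fun j => ?_).contDiffAt (hMo.mem_nhds hw)
    exact contDiffOn_const
  have hstrict := hsmooth.hasStrictFDerivAt' hder (by simp)
  have hmap : Filter.map (fun z => π (F z)) (nhds w) = nhds (π (F w)) := by
    refine hstrict.map_nhds_eq_of_surj (LinearMap.range_eq_top.2 fun c => ?_)
    exact ⟨(conformalFactor F w)⁻¹ * c, by simp [hρ]⟩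
  have hmem : M ∩ F ⁻¹' V ∈ nhds w :=
    Filter.inter_mem (hMo.mem_nhds hw) (hcont (hVo.mem_nhds hwV))
  have himg : (fun z => π (F z)) '' (M ∩ F ⁻¹' V) ∈ nhds (π (F w)) :=
    hmap ▸ Filter.image_mem_map hmem
  refine ⟨V ∩ π ⁻¹' interior ((fun z => π (F z)) '' (M ∩ F ⁻¹' V)),
    hVo.inter (isOpen_interior.preimage hπ), ⟨hwV, mem_interior_iff_mem_nhds.2 himg⟩, ?_⟩
  rintro x ⟨hxV, hxπ⟩ hxv hxs
  obtain ⟨z, ⟨hzM, hzV⟩, hz⟩ := interior_subset hxπ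
  refine ⟨z, hzM, ?_⟩
  set d := F z - x with hd
  have hdv : lor d v = 0 := by
    have h1 : d = (F z - p) - (x - p) := by rw [hd]; module
    rw [h1, lor_sub_left, hxv, hFp z hzM, lor_neg_left, lor_smul_left, lor_comm, hvH z hzM]
    ring
  have hdw : lorC (toC d) (fw F w) = 0 := by
    have h1 : lorC (toC d) (conjVec (fw F w)) = 0 := by
      have : lorC (toC d) (conjVec (fw F w)) = π (F z) - π x := by
        simp only [hd, π, lorC, toC, Pi.sub_apply]
        push_cast
        ring
      rw [this, sub_eq_zero]
      exact hz
    rw [← conjVec_toC, ← conjVec_conjVec (fw F w), lorC_conjVec, h1, map_zero]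
  have hdH := eq_smul_of_orthogonal hF hw (hv w hw) (lorC_meanCurvature_fw hF hMo hw) hdw
    (hvH w hw) hvv (by rw [hs w hw]; exact hs0) hdv
  set c := lor d (meanCurvature F w) / lor (meanCurvature F w) (meanCurvature F w)
  have hzs : lor (F z - p) (F z - p) = s⁻¹ := by
    rw [hFp z hzM, lor_neg_left, lor_neg_right, lor_smul_left, lor_smul_right, hs z hzM]
    field_simp
  -- Both points lie on the same quadric, so their difference `d = cH` is orthogonal to the sum of
  -- their position vectors from `p`.
  have hprod : c * (lor (F z - p) H + lor (x - p) H) = 0 := by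
    have h1 : lor ((F z - p) + (x - p)) d = 0 := by
      have h2 : d = (F z - p) - (x - p) := by rw [hd]; module
      rw [h2, lor_add_left, lor_sub_right (F z - p) (F z - p), lor_sub_right (x - p) (F z - p),
        hzs, hxs, lor_comm (x - p)]
      ring
    rw [hdH, lor_smul_right, lor_add_left] at h1
    exact h1
  have hc : c = 0 := by
    refine (mul_eq_zero.1 hprod).resolve_right (ne_of_lt ?_)
    exact add_neg hzV hxV
  rw [hc, zero_smul] at hdH
  exact sub_eq_zero.1 hdH

end immersion

/-! ### Isometries and congruence with the model surfaces. -/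

/-- The reflection of Minkowski space along a non-null vector. -/
noncomputable def lorReflection (u : L4) (hu : lor u u ≠ 0) : L4 ≃ₗ[ℝ] L4 :=
  LinearEquiv.ofInvolutive
    { toFun := fun x => x - (2 * lor x u / lor u u) • u
      map_add' := fun x y => by rw [lor_add_left]; module
      map_smul' := fun c x => by
        rw [lor_smul_left, RingHom.id_apply]; module }
    (fun x => by
      simp only [LinearMap.coe_mk, AddHom.coe_mk, lor_sub_left, lor_smul_left]
      rw [div_mul_cancel₀ _ hu]
      module)

lemma lorReflection_apply (u : L4) (hu : lor u u ≠ 0) (x : L4) :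
    lorReflection u hu x = x - (2 * lor x u / lor u u) • u := rfl

lemma lor_lorReflection (u : L4) (hu : lor u u ≠ 0) (x y : L4) :
    lor (lorReflection u hu x) (lorReflection u hu y) = lor x y := by
  simp only [lorReflection_apply, lor_sub_left, lor_sub_right, lor_smul_left, lor_smul_right]
  rw [lor_comm u y]
  field_simp
  ring

/-- A linear isometry taking a non-null vector to any other one of the same norm, up to sign. -/
lemma exists_linear_isometry {v e : L4} (h : lor v v = lor e e) (hv : lor v v ≠ 0) :
    ∃ L : L4 ≃ₗ[ℝ] L4, (∀ x y, lor (L x) (L y) = lor x y) ∧ (L v = e ∨ L v = -e) := by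
  -- The norms of `v - e` and `v + e` add up to `4⟨v, v⟩ ≠ 0`, so one of the two reflections exists;
  -- they send `v` to `e` and to `-e`.
  by_cases h1 : lor (v - e) (v - e) = 0
  · have h2 : lor (v + e) (v + e) ≠ 0 := by
      intro h2
      simp only [lor_sub_left, lor_sub_right, lor_add_left, lor_add_right] at h1 h2
      apply hv
      linarith
    refine ⟨lorReflection _ h2, lor_lorReflection _ h2, Or.inr ?_⟩
    have h3 : 2 * lor v (v + e) / lor (v + e) (v + e) = 1 := by
      rw [div_eq_one_iff_eq h2]
      simp only [lor_add_left, lor_add_right]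
      rw [lor_comm e v]
      linarith
    rw [lorReflection_apply, h3]
    module
  · refine ⟨lorReflection _ h1, lor_lorReflection _ h1, Or.inl ?_⟩
    have h3 : 2 * lor v (v - e) / lor (v - e) (v - e) = 1 := by
      rw [div_eq_one_iff_eq h1]
      simp only [lor_sub_left, lor_sub_right]
      rw [lor_comm e v]
      linarith
    rw [lorReflection_apply, h3]
    module

/-- A criterion for congruence, by the isometry `x ↦ L (x - p)`, to an open piece of a surface. -/
lemma congruentToOpenPiece_of_local {S Q : Set L4} (L : L4 ≃ₗ[ℝ] L4)
    (hL : ∀ x y, lor (L x) (L y) = lor x y) (p : L4) (hSQ : ∀ x ∈ S, L (x - p) ∈ Q)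
    (hloc : ∀ x ∈ S, ∃ U : Set L4, IsOpen U ∧ x ∈ U ∧ ∀ y ∈ U, L (y - p) ∈ Q → y ∈ S) :
    CongruentToOpenPiece S Q := by
  let T : L4 ≃ᵃ[ℝ] L4 := (AffineEquiv.constVAdd ℝ L4 (-p)).trans L.toAffineEquiv
  have hT : ∀ x, T x = L (x - p) := fun x => by
    simp [T, sub_eq_neg_add]
  choose! U hUo hxU hU using hloc
  have hW : IsOpen (⋃ x ∈ S, U x) := isOpen_biUnion hUo
  refine ⟨T '' (⋃ x ∈ S, U x), T.toContinuousAffineEquiv.toHomeomorph.isOpenMap _ hW, T,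
    fun x y => ?_, ?_⟩
  · have : T x - T y = L (x - y) := by
      rw [hT, hT, ← map_sub]; congr 1; module
    rw [this, hL]
  · ext y
    constructor
    · rintro ⟨x, hx, rfl⟩
      exact ⟨⟨x, Set.mem_biUnion hx (hxU x hx), rfl⟩, by rw [hT]; exact hSQ x hx⟩
    · rintro ⟨⟨x, hx, rfl⟩, hy⟩
      obtain ⟨z, hz, hxz⟩ := Set.mem_iUnion₂.1 hx
      exact ⟨x, hU z hz x hxz (by rw [← hT]; exact hy), rfl⟩

section immersion

variable {F : ℂ → L4} {M : Set ℂ} {w : ℂ}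

lemma mem_roundSphere_iff {L : L4 ≃ₗ[ℝ] L4} (hL : ∀ x y, lor (L x) (L y) = lor x y) {v : L4}
    (hLv : L v = Pi.single 0 1 ∨ L v = -Pi.single 0 1) (r : ℝ) (x : L4) :
    L x ∈ roundSphere r ↔ lor x v = 0 ∧ lor x x = r ^ 2 := by
  have h0 : L x 0 = 0 ↔ lor x v = 0 := by
    rw [← hL x v]
    rcases hLv with h | h <;> rw [h] <;> simp [lor]
  rw [← h0, ← hL x x]
  rfl

lemma mem_hyperbolicSurface_iff {L : L4 ≃ₗ[ℝ] L4} (hL : ∀ x y, lor (L x) (L y) = lor x y)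
    {v : L4} (hLv : L v = Pi.single 3 1 ∨ L v = -Pi.single 3 1) (r : ℝ) (x : L4) :
    L x ∈ hyperbolicSurface r ↔ lor x v = 0 ∧ lor x x = -r ^ 2 ∧ 0 < L x 0 := by
  have h0 : L x 3 = 0 ↔ lor x v = 0 := by
    rw [← hL x v]
    rcases hLv with h | h <;> rw [h] <;> simp [lor]
  rw [← h0, ← hL x x]
  rfl

/-- The norm of a unit normal of a hyperplane containing the surface has the sign opposite to that
of the norm of the mean curvature vector. -/
lemma lor_normal_mul_neg (hF : IsConformalImmersion F M) (hMo : IsOpen M)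
    (hMc : IsPreconnected M) (humb : IsTotallyUmbilical F M) (hw : w ∈ M)
    (hs : lor (meanCurvature F w) (meanCurvature F w) ≠ 0) {v : L4} (hvv : lor v v ≠ 0)
    (hv : ∀ z ∈ M, lorC (toC v) (fw F z) = 0) :
    lor v v * lor (meanCurvature F w) (meanCurvature F w) < 0 := by
  obtain ⟨n, hn, hnF⟩ := exists_constant_normal hF hMo hMc humb hw
  have hH := lor_meanCurvature_of_orthogonal hF hMo hv hw
  have hnH := lor_meanCurvature_of_orthogonal hF hMo hnF hw
  -- `H` and `n` span the normal plane and `v` is orthogonal to `H`, so `v` is a multiple of `n`,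
  -- whose norm is `-⟨H, H⟩`.
  have h := eq_smul_of_orthogonal hF hw (lorC_meanCurvature_fw hF hMo hw) (hnF w hw) (hv w hw)
    (by rw [lor_comm]; exact hnH) hs (by rw [hn]; exact neg_ne_zero.2 hs) hH
  set c := lor v n / lor n n
  have h1 : lor v v = c ^ 2 * -lor (meanCurvature F w) (meanCurvature F w) := by
    rw [← hn, h, lor_smul_left, lor_smul_right]; ring
  have hc : c ≠ 0 := fun hc => hvv (by rw [h1, hc]; ring)
  rw [h1]
  have : 0 < (c * lor (meanCurvature F w) (meanCurvature F w)) ^ 2 :=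
    sq_pos_of_ne_zero (mul_ne_zero hc hs)
  nlinarith

/-- A totally umbilical surface with non-null mean curvature vector in a hyperplane with unit
normal `v` is an open piece of a round sphere or of a hyperbolic surface. -/
lemma congruentToOpenPiece_of_unit_normal (hF : IsConformalImmersion F M) (hMo : IsOpen M)
    (hMc : IsPreconnected M) (humb : IsTotallyUmbilical F M) (hw : w ∈ M)
    (hs0 : lor (meanCurvature F w) (meanCurvature F w) ≠ 0) {v : L4}
    (hv : ∀ z ∈ M, lorC (toC v) (fw F z) = 0) :
    (lor v v = -1 → ∃ r : ℝ, 0 < r ∧ CongruentToOpenPiece (F '' M) (roundSphere r)) ∧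
    (lor v v = 1 → ∃ r : ℝ, 0 < r ∧ CongruentToOpenPiece (F '' M) (hyperbolicSurface r)) := by
  obtain ⟨p, hp⟩ := exists_center hF hMo hMc humb hw rfl hs0
  have hsign := fun h0 => lor_normal_mul_neg hF hMo hMc humb hw hs0 (v := v) h0 hv
  have hs : ∀ z ∈ M, lor (meanCurvature F z) (meanCurvature F z) =
      lor (meanCurvature F w) (meanCurvature F w) := fun z hz =>
    lor_meanCurvature_constant hF hMo hMc humb hz hw
  generalize lor (meanCurvature F w) (meanCurvature F w) = s at hs0 hp hsign hs
  have hFp : ∀ z ∈ M, F z - p = -(s⁻¹ • meanCurvature F z) := fun z hz => by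
    rw [hp z hz]; module
  have hFv : ∀ z ∈ M, lor (F z - p) v = 0 := fun z hz => by
    rw [hFp z hz, lor_neg_left, lor_smul_left, lor_comm,
      lor_meanCurvature_of_orthogonal hF hMo hv hz]
    ring
  have hFs : ∀ z ∈ M, lor (F z - p) (F z - p) = s⁻¹ := fun z hz => by
    rw [hFp z hz, lor_neg_left, lor_neg_right, lor_smul_left, lor_smul_right, hs z hz]
    field_simp
  refine ⟨fun hvv => ?_, fun hvv => ?_⟩
  · have hspos : 0 < s := by
      have := hsign (by rw [hvv]; norm_num)
      rw [hvv] at this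
      linarith
    have hr : Real.sqrt s⁻¹ ^ 2 = s⁻¹ := Real.sq_sqrt (inv_pos.2 hspos).le
    obtain ⟨L, hL, hLv⟩ := exists_linear_isometry (v := v) (e := Pi.single 0 1)
      (by rw [hvv]; simp [lor]) (by rw [hvv]; norm_num)
    refine ⟨Real.sqrt s⁻¹, Real.sqrt_pos.2 (inv_pos.2 hspos),
      congruentToOpenPiece_of_local L hL p ?_ ?_⟩
    · rintro _ ⟨z, hz, rfl⟩
      rw [mem_roundSphere_iff hL hLv, hr]
      exact ⟨hFv z hz, hFs z hz⟩
    · rintro _ ⟨z, hz, rfl⟩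
      obtain ⟨U, hUo, hzU, hU⟩ := exists_isOpen_inter_subset_image hF hMo hs0 hs hp
        (by rw [hvv]; norm_num) hv hz
      refine ⟨U, hUo, hzU, fun y hy hyQ => ?_⟩
      rw [mem_roundSphere_iff hL hLv, hr] at hyQ
      exact hU y hy hyQ.1 hyQ.2
  · have hsneg : s < 0 := by
      have := hsign (by rw [hvv]; norm_num)
      rw [hvv] at this
      linarith
    have hsn : 0 < -s⁻¹ := neg_pos.2 (inv_lt_zero.2 hsneg)
    have hr : -Real.sqrt (-s⁻¹) ^ 2 = s⁻¹ := by rw [Real.sq_sqrt hsn.le, neg_neg]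
    have hLex : ∃ L : L4 ≃ₗ[ℝ] L4, (∀ x y, lor (L x) (L y) = lor x y) ∧
        (L v = Pi.single 3 1 ∨ L v = -Pi.single 3 1) ∧ 0 < L (F w - p) 0 := by
      obtain ⟨L, hL, hLv⟩ := exists_linear_isometry (v := v) (e := Pi.single 3 1)
        (by rw [hvv]; simp [lor]) (by rw [hvv]; norm_num)
      have h0 : L (F w - p) 0 ≠ 0 := time_ne_zero_of_lor_neg (by
        rw [hL, hFs w hw]; exact inv_lt_zero.2 hsneg)
      rcases lt_or_gt_of_ne h0 with h | h
      -- Composing with `-id` moves the surface to the upper sheet; it only flips the sign of `L v`,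
      -- which was left open.
      · refine ⟨L.trans (LinearEquiv.neg ℝ), fun x y => ?_, ?_, ?_⟩
        · simp only [LinearEquiv.trans_apply, LinearEquiv.neg_apply]
          rw [lor_neg_left, lor_neg_right, neg_neg, hL]
        · simp only [LinearEquiv.trans_apply, LinearEquiv.neg_apply]
          rcases hLv with h' | h' <;> rw [h']
          · exact Or.inr rfl
          · exact Or.inl (neg_neg _)
        · simpa only [LinearEquiv.trans_apply, LinearEquiv.neg_apply, Pi.neg_apply, neg_pos]
            using h
      · exact ⟨L, hL, hLv, h⟩
    obtain ⟨L, hL, hLv, hLw⟩ := hLex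
    have hcont : ContinuousOn (fun z => L (F z - p) 0) M := by
      have h1 : Continuous L := L.toLinearMap.continuous_of_finiteDimensional
      exact (continuous_apply 0).comp_continuousOn (h1.comp_continuousOn
        (hF.smooth.continuousOn.sub continuousOn_const))
    -- The time coordinate never vanishes on timelike vectors, so a connected surface stays on one
    -- sheet.
    have hpos := pos_of_pos_of_ne_zero hMc hcont (fun z hz => time_ne_zero_of_lor_neg (by
        rw [hL, hFs z hz]; exact inv_lt_zero.2 hsneg)) hw hLw
    refine ⟨Real.sqrt (-s⁻¹), Real.sqrt_pos.2 hsn, congruentToOpenPiece_of_local L hL p ?_ ?_⟩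
    · rintro _ ⟨z, hz, rfl⟩
      rw [mem_hyperbolicSurface_iff hL hLv, hr]
      exact ⟨hFv z hz, hFs z hz, hpos z hz⟩
    · rintro _ ⟨z, hz, rfl⟩
      obtain ⟨U, hUo, hzU, hU⟩ := exists_isOpen_inter_subset_image hF hMo hs0 hs hp
        (by rw [hvv]; norm_num) hv hz
      refine ⟨U, hUo, hzU, fun y hy hyQ => ?_⟩
      rw [mem_hyperbolicSurface_iff hL hLv, hr] at hyQ
      exact hU y hy hyQ.1 hyQ.2.1

lemma exists_unit_normal (hF : IsConformalImmersion F M) (hMo : IsOpen M)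
    (hMc : IsPreconnected M) (humb : IsTotallyUmbilical F M) (hw : w ∈ M)
    (hs0 : lor (meanCurvature F w) (meanCurvature F w) ≠ 0) :
    ∃ v : L4, (lor v v = -1 ∨ lor v v = 1) ∧ ∀ w₀ ∈ M, F '' M ⊆ affHyperplane (F w₀) v := by
  obtain ⟨n, hn, hnF⟩ := exists_constant_normal hF hMo hMc humb hw
  have hn0 : lor n n ≠ 0 := by rw [hn]; exact neg_ne_zero.2 hs0
  have habs : 0 < |lor n n| := abs_pos.2 hn0
  refine ⟨(Real.sqrt |lor n n|)⁻¹ • n, ?_, ?_⟩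
  · have h1 : lor ((Real.sqrt |lor n n|)⁻¹ • n) ((Real.sqrt |lor n n|)⁻¹ • n) =
        lor n n / |lor n n| := by
      rw [lor_smul_left, lor_smul_right, ← mul_assoc, ← mul_inv, Real.mul_self_sqrt habs.le]
      ring
    rw [h1]
    rcases lt_or_gt_of_ne hn0 with h | h
    · left; rw [abs_of_neg h]; field_simp
    · right; rw [abs_of_pos h]; field_simp
  · rintro w₀ hw₀ _ ⟨z, hz, rfl⟩
    change lor (F z - F w₀) _ = 0
    rw [lor_smul_right, lor_sub_left, lor_comm (F z), lor_comm (F w₀),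
      lor_constant_of_orthogonal hF hMo hMc hnF hz hw₀, sub_self, mul_zero]

end immersion

/-! ### The main theorem. -/

theorem mainTheorem2 (M : Set ℂ) (hMo : IsOpen M) (hMc : IsConnected M)
    (hMs : IsSimplyConnected M) (F : ℂ → L4)
    (hF : IsConformalImmersion F M)
    (hden : ∀ w ∈ M, den F w ≠ 0)
    (humb : IsTotallyUmbilical F M)
    (ha : IsAntiHolomorphicOn (aMap F) M) (hb : IsAntiHolomorphicOn (bMap F) M)
    (hac : ¬ IsConstantOn (aMap F) M) (hbc : ¬ IsConstantOn (bMap F) M) :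
    ((∃ w ∈ M, ¬ IsPastTimelike (meanCurvature F w)) →
      ∃ f : ℂ → L4, IsConformalImmersion f M ∧ Set.MapsTo f M futureCone ∧ SameData f F M) ∧
    ((∀ w ∈ M, IsPastTimelike (meanCurvature F w)) →
      ∃ f : ℂ → L4, IsConformalImmersion f M ∧ Set.MapsTo f M pastCone ∧ SameData f F M) ∧
    (∃ v : L4, (lor v v = -1 ∨ lor v v = 1) ∧
      ∀ w₀ ∈ M, F '' M ⊆ affHyperplane (F w₀) v) ∧
    (∀ v : L4, ∀ w₀ ∈ M, F '' M ⊆ affHyperplane (F w₀) v →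
      (lor v v = -1 → ∃ r : ℝ, 0 < r ∧ CongruentToOpenPiece (F '' M) (roundSphere r)) ∧
      (lor v v = 1 → ∃ r : ℝ, 0 < r ∧
        CongruentToOpenPiece (F '' M) (hyperbolicSurface r))) := by
  have hs0 : ∀ w ∈ M, lor (meanCurvature F w) (meanCurvature F w) ≠ 0 := fun w hw =>
    lor_meanCurvature_ne_zero hF hMo hMc humb hden ha hb hac hbc hw
  obtain ⟨w₁, hw₁⟩ := hMc.nonempty
  refine ⟨?_, fun hpast => ?_,
    exists_unit_normal hF hMo hMc.isPreconnected humb hw₁ (hs0 w₁ hw₁), ?_⟩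
  · rintro ⟨w, hw, hnot⟩
    refine (exists_lightCone_translate hF hMo hMc humb hw rfl (hs0 w hw)).1 ?_
    -- One point suffices, since `s` and, when `s < 0`, the time direction of `H` do not vary. A
    -- timelike `H` that is not past directed is future directed.
    rcases lt_or_gt_of_ne (hs0 w hw) with h | h
    · exact Or.inr (lt_of_le_of_ne (not_lt.1 fun h' => hnot ⟨h, h'⟩)
        (time_ne_zero_of_lor_neg h).symm)
    · exact Or.inl h
  · exact (exists_lightCone_translate hF hMo hMc humb hw₁ rfl (hs0 w₁ hw₁)).2 (hpast w₁ hw₁)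
  · intro v w₀ hw₀ hsub
    refine congruentToOpenPiece_of_unit_normal hF hMo hMc.isPreconnected humb hw₀ (hs0 w₀ hw₀)
      fun z hz => orthogonal_of_lor_constant hF hMo (c := lor v (F w₀)) (fun u hu => ?_) hz
    have h : lor (F u - F w₀) v = 0 := hsub ⟨u, hu, rfl⟩
    rw [lor_sub_left, lor_comm, lor_comm (F w₀)] at h
    linarith
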